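/- Let $\Delta=\{x\in\mathbb R^3: x_1,x_2,x_3\ge 0,\ x_1+x_2+x_3=1\}$, and for $j\in\{1,2,3\}$ let $T_j:\Delta\to\Delta$ be the map with $(T_jx)_j=\frac{1}{2-x_j}$ and $(T_jx)_i=\frac{x_i}{2-x_j}$ for $i\ne j$. The Rauzy gasket $\mathcal G$ is the smallest nonempty closed subset of $\Delta$ with $\mathcal G=T_1\mathcal G\cup T_2\mathcal G\cup T_3\mathcal G$. For a word $\underline i=(i_1,\dots,i_n)\in\{1,2,3\}^n$ put $\Delta_{\underline i}=T_{i_1}\circ\cdots\circ T_{i_n}(\Delta)$. Fix an integer $m\ge 2$, put $\lambda=\frac32-\frac1{\sqrt3}$, and let $\delta>\frac{1-\lambda}{3-\lambda}$. For $1\le k<m$ let $\mathcal V_k=\{(1^k,2,v_{k+2},\dots,v_{m+1}) : v_{k+2},\dots,v_{m+1}\in\{1,2,3\}\}$, a set of words of length $m+1$, let $\mathcal V=\bigcup_{k=1}^{m-1}\mathcal V_k$, and let $\star=(1,2^m)\in\mathcal V$. For $\underline w=(w_1,\dots,w_{m+1})\in\mathcal V_k$ write $\underline w\mapsto_1(1,w_1,\dots,w_m)$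 if $k\le m-2$ and $\underline w\mapsto_1 m$ if $k=m-1$ (here $m$ is an extra index); for $j=2,3$ write $\underline w\mapsto_j\underline v$ for the $\underline v\in\mathcal V_1$ that is obtained from $(j,w_1,\dots,w_m)$ by a permutation of the letters $1,2,3$. Let $B$ be the matrix indexed by $\mathcal V\cup\{m\}$ with $B_{\underline v,\underline w}=\max_{x\in\Delta_{\underline w}}(2-x_j)^{-3\delta-\lambda(1-\delta)}$ if $\underline w\mapsto_j\underline v$, and all other entries (in particular the column of $m$) equal to $0$. For $k\in\mathbb N$ put $$a_k=\Big(\frac{k+1}{2k+1}\Big)^{3\delta+\lambda(1-\delta)}+\frac1{8^\delta}\Big(\frac{k+1}{2k+1}\Big)^{\lambda(1-\delta)},\qquad b_k=\Big(\frac{k+2}{k+3}\Big)^{3\delta+\lambda(1-\delta)}.$$ Let $D$ be the infinite matrix indexed by $\mathcal V\cup\{m,m+1,m+2,\dots\}$ that is obtained by extending $B$ by zeros and then adding $a_k$ to the entry $(\star,k)$ and $b_k$ to the entry $(k+1,k)$, for every $k\ge m$. (i) If $\sum_{k=1}^\infty (D^k)_{\star,\star}\le 1$, then $\dim_H(\mathcal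 G)\le 1+\delta$. (ii) If $$\sum_{k=1}^\infty (B^k)_{m,\star}\cdot\sum_{k=m}^\infty a_k\prod_{i=m}^{k-1}b_i\le 1,$$ then $\dim_H(\mathcal G)\le 1+\delta$. (iii) The hypothesis of (i) implies that of (ii). (All sums have nonnegative terms and are taken in $[0,\infty]$.) -/

import Mathlib

open scoped ENNReal

noncomputable section

namespace RauzyGasket

/-! ### The gasket

Letters and coordinates are indexed by `Fin 3`; the letters `1, 2, 3` are `0, 1, 2 : Fin 3`. -/

/-- Three-dimensional Euclidean space. -/
abbrev E3 : Type := EuclideanSpace ℝ (Fin 3)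

/-- The standard 2-simplex. -/
def simplex : Set E3 := {x | (∀ i, 0 ≤ x i) ∧ ∑ i, x i = 1}

/-- The projective map `T_j`: the `j`-th coordinate becomes `1 / (2 - x_j)`, every other
coordinate `x_i` becomes `x_i / (2 - x_j)`. -/
def T (j : Fin 3) (x : E3) : E3 :=
  WithLp.toLp 2 (fun i => if i = j then 1 / (2 - x j) else x i / (2 - x j))

/-- The Rauzy gasket: the smallest nonempty closed subset `K` of the simplex such that
`K = T_1 K ∪ T_2 K ∪ T_3 K`. -/
def gasket : Set E3 :=
  ⋂₀ {K | K ⊆ simplex ∧ IsClosed K ∧ K.Nonempty ∧ K = ⋃ j, T j '' K}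

/-- The composition `T_{i_1} ∘ ⋯ ∘ T_{i_n}` for the word `[i_1, …, i_n]`. -/
def wordMap (l : List (Fin 3)) (x : E3) : E3 := l.foldr T x

/-- The triangle `Δ_i`, for a word `i = (i_1, …, i_n)`. -/
def triangle {n : ℕ} (w : Fin n → Fin 3) : Set E3 := wordMap (List.ofFn w) '' simplex

/-! ### The index set -/

/-- `IsV m k v` says that `v` is a word `(1^k, 2, v_{k+2}, …, v_{m+1})` of length `m + 1`
(used for `1 ≤ k < m` only). -/
def IsV (m k : ℕ) (v : Fin (m + 1) → Fin 3) : Prop :=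
  (∀ i : Fin (m + 1), (i : ℕ) < k → v i = 0) ∧ (∀ i : Fin (m + 1), (i : ℕ) = k → v i = 1)

/-- The finite set `𝒱 = ⋃_{1 ≤ k < m} 𝒱_k`. -/
def V (m : ℕ) : Type := {v : Fin (m + 1) → Fin 3 // ∃ k, 1 ≤ k ∧ k < m ∧ IsV m k v}

instance (m : ℕ) : Fintype (V m) := by
  classical
  exact inferInstanceAs
    (Fintype {v : Fin (m + 1) → Fin 3 // ∃ k, 1 ≤ k ∧ k < m ∧ IsV m k v})

instance (m : ℕ) : DecidableEq (V m) :=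
  inferInstanceAs
    (DecidableEq {v : Fin (m + 1) → Fin 3 // ∃ k, 1 ≤ k ∧ k < m ∧ IsV m k v})

/-- The word `(1, 2^m)`. -/
def starWord (m : ℕ) : Fin (m + 1) → Fin 3 := fun i => if i = 0 then 0 else 1

/-- The distinguished element `⋆ = (1, 2^m)` of `𝒱`. -/
def star (m : ℕ) (hm : 2 ≤ m) : V m :=
  ⟨starWord m, 1, le_rfl, hm, by
    refine ⟨fun i hi => ?_, fun i hi => ?_⟩
    · have h : i = 0 := Fin.ext (by simpa using hi)
      simp [starWord, h]
    · have h : i ≠ 0 := by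
        rintro rfl
        simp at hi
      simp [starWord, h]⟩

/-- Equivalence of words: they agree up to a permutation of the three letters. -/
def WordEquiv {n : ℕ} (u v : Fin n → Fin 3) : Prop :=
  ∃ π : Equiv.Perm (Fin 3), ∀ i, π (u i) = v i

/-- The word `(j, w_1, …, w_m)`, for `w = (w_1, …, w_{m+1})`. -/
def shiftWord {m : ℕ} (j : Fin 3) (w : Fin (m + 1) → Fin 3) : Fin (m + 1) → Fin 3 :=
  Fin.cons j (Fin.init w)

/-- The index set `𝒱 ∪ {m}`, where `Sum.inr ()` is the extra index `m`. -/
abbrev IdxB (m : ℕ) : Type := V m ⊕ Unit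

/-- The adjacency relation `w ↦_j v`, for `w ∈ 𝒱` and `v ∈ 𝒱 ∪ {m}`. -/
def Adj {m : ℕ} (j : Fin 3) (w : V m) : IdxB m → Prop
  | Sum.inl v =>
      (j = 0 ∧ v.1 = shiftWord 0 w.1) ∨
      (j ≠ 0 ∧ IsV m 1 v.1 ∧ WordEquiv (shiftWord j w.1) v.1)
  | Sum.inr _ => j = 0 ∧ IsV m (m - 1) w.1

/-! ### The matrices -/

/-- The constant `λ = 3/2 - 1/√3`. -/
def lam : ℝ := 3 / 2 - 1 / Real.sqrt 3

/-- `max_{x ∈ Δ_w} (2 - x_j)^{-3δ - λ(1-δ)}`. -/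
def weight {m : ℕ} (δ : ℝ) (j : Fin 3) (w : V m) : ℝ :=
  sSup ((fun x : E3 => (2 - x j) ^ (-(3 * δ) - lam * (1 - δ))) '' triangle w.1)

open Classical in
/-- The finite matrix `B`, indexed by `𝒱 ∪ {m}`: the entry `B_{v,w}` is the weight
`max_{x ∈ Δ_w} (2 - x_j)^{-3δ - λ(1-δ)}` if `w ↦_j v` and zero if there is no such `j`.
(For given `v`, `w` at most one `j` satisfies `w ↦_j v`.) The column of the index `m` is zero. -/
def B (m : ℕ) (δ : ℝ) : Matrix (IdxB m) (IdxB m) ℝ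
  | v, Sum.inl w => ∑ j : Fin 3, if Adj j w v then weight δ j w else 0
  | _, Sum.inr _ => 0

/-- The constants `a_k`. -/
def a (δ : ℝ) (k : ℕ) : ℝ :=
  (((k : ℝ) + 1) / (2 * k + 1)) ^ (3 * δ + lam * (1 - δ)) +
    1 / (8 : ℝ) ^ δ * (((k : ℝ) + 1) / (2 * k + 1)) ^ (lam * (1 - δ))

/-- The constants `b_k`. -/
def b (δ : ℝ) (k : ℕ) : ℝ :=
  (((k : ℝ) + 2) / (k + 3)) ^ (3 * δ + lam * (1 - δ))

/-- The index set `𝒱 ∪ {m, m+1, …}`. -/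
abbrev IdxD (m : ℕ) : Type := V m ⊕ {k : ℕ // m ≤ k}

open Classical in
/-- The infinite matrix `D`: it extends `B` by zero, plus the row `a_m, a_{m+1}, …` at the
index `⋆` and the entries `D_{k+1,k} = b_k` for `k ≥ m`. -/
def D (m : ℕ) (δ : ℝ) : Matrix (IdxD m) (IdxD m) ℝ
  | Sum.inl v, Sum.inl w => B m δ (Sum.inl v) (Sum.inl w)
  | Sum.inl v, Sum.inr k =>
      (if (k : ℕ) = m then B m δ (Sum.inl v) (Sum.inr ()) else 0) +
        (if v.1 = starWord m then a δ k else 0)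
  | Sum.inr l, Sum.inl w => if (l : ℕ) = m then B m δ (Sum.inr ()) (Sum.inl w) else 0
  | Sum.inr l, Sum.inr k =>
      (if (l : ℕ) = m ∧ (k : ℕ) = m then B m δ (Sum.inr ()) (Sum.inr ()) else 0) +
        (if (l : ℕ) = k + 1 then b δ k else 0)

open Classical in
/-- The entries of the powers of a matrix with nonnegative entries over a possibly infinite
index set, as sums in `[0, ∞]`. -/
def infPow {ι : Type} (M : Matrix ι ι ℝ) : ℕ → ι → ι → ℝ≥0∞
  | 0, i, j => if i = j then 1 else 0
  | k + 1, i, j => ∑' l, infPow M k i l * ENNReal.ofReal (M l j)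

/-- `∑_{k ≥ 1} (D^k)_{⋆,⋆}`, as a sum in `[0, ∞]`. -/
def sumD (m : ℕ) (hm : 2 ≤ m) (δ : ℝ) : ℝ≥0∞ :=
  ∑' k : ℕ, infPow (D m δ) (k + 1) (Sum.inl (star m hm)) (Sum.inl (star m hm))

/-- `∑_{k ≥ 1} (B^k)_{m,⋆}`, as a sum in `[0, ∞]`. -/
def sumB (m : ℕ) (hm : 2 ≤ m) (δ : ℝ) : ℝ≥0∞ :=
  ∑' k : ℕ, ENNReal.ofReal ((B m δ ^ (k + 1)) (Sum.inr ()) (Sum.inl (star m hm)))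

/-- `∑_{k ≥ m} a_k ∏_{i = m}^{k-1} b_i`, as a sum in `[0, ∞]`. -/
def sumAB (m : ℕ) (δ : ℝ) : ℝ≥0∞ :=
  ∑' k : {k : ℕ // m ≤ k}, ENNReal.ofReal (a δ k * ∏ i ∈ Finset.Ico m (k : ℕ), b δ i)

end RauzyGasket

end

open scoped ENNReal

noncomputable section

namespace RauzyGasket

open Set Filter Topology

/-! ### Elementary inequalities -/

/-! A triangle with longest side `d` and height `h` is covered by about `d / h` sets of diameter
about `h`, which contribute `(d / h) h^(1+δ) = (d h)^δ d^(1-δ)`, that is, area to the power `δ`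
times diameter to the power `1 - δ`. This is `cost`. Apart from countably many points, every point
of the gasket has a code with infinitely many changes of letter, so it lies in infinitely many
triangles whose word is an arbitrary prefix followed by `m + 1` letters, the first two distinct. If
the costs of all these triangles are summable, a Borel–Cantelli argument gives dimension at most `1
+ δ` (`dimH_gasket_le_of_summable`).

Under `T_j` the determinant of the vertices is divided exactly by the product of the three values `2
- x_j` (`vdet_T`), and lengths shrink at least by the factor `(2 - x_j)^(-λ)` at the worst vertex
(`dist_T_le`); this is what fixes `λ`. Hence the cost shrinks by `(2 - x_j)^(-3δ-λ(1-δ))`. Up to a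
permutation of letters the first letters of a word form a state: an element of `𝒱`, or an initial
run of exactly `k ≥ m` equal letters. Prepending a letter moves between states, and `D` bounds the
cost factors: `b_k` for prolonging a run, and `a_k` for the two other letters together, which both
lead to `⋆`.

An entry `D_{v,w}` is the weight of a step from `w` to `v`, so entries of powers are weights of
paths. A path from `⋆` to `m` by `B`, then along `m, m+1, …, k`, then back to `⋆` is a closed path
of `D`; thus the product in (ii) is at most the sum in (i), which is (iii) and reduces (i) to (ii).

For (ii), `h(w) = ∑ (B^n)_{m,w}`, together with `h(⋆) S_k` on runs, `S_k` being the tail series at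
`k`, is superharmonic for `D` (`exists_superharmonic`); the hypothesis is precisely the inequality
needed at `m`, where `h = 1`. Equality being allowed, there is no strict gain at `δ` itself. For `δ'
> δ` a factor `θ < 1` is gained on all transitions except the prolongation of runs, and the slack `1
- θ` pays for the cost of the current triangle (`exists_costSum_bound`). Then `δ'` tends to `δ`. -/

/-- `sinh (c x) ≥ c sinh x` for `c ≥ 1` and `x ≥ 0`. -/
theorem mul_sinh_le_sinh_mul {c x : ℝ} (hc : 1 ≤ c) (hx : 0 ≤ x) :
    c * Real.sinh x ≤ Real.sinh (c * x) := by
  have hd : ∀ y : ℝ, HasDerivAt (fun y => Real.sinh (c * y) - c * Real.sinh y)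
      (Real.cosh (c * y) * c - c * Real.cosh y) y := by
    intro y
    have h1 : HasDerivAt (fun y : ℝ => c * y) c y := by
      simpa using (hasDerivAt_id y).const_mul c
    exact (h1.sinh).sub ((Real.hasDerivAt_sinh y).const_mul c)
  have hmono : MonotoneOn (fun y => Real.sinh (c * y) - c * Real.sinh y) (Ici 0) := by
    refine monotoneOn_of_deriv_nonneg (convex_Ici 0)
      (fun y _ => (hd y).continuousAt.continuousWithinAt)
      (fun y _ => (hd y).differentiableAt.differentiableWithinAt) ?_
    intro y hy
    rw [interior_Ici] at hy
    have hy0 : (0 : ℝ) < y := hy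
    rw [(hd y).deriv]
    have : Real.cosh y ≤ Real.cosh (c * y) := by
      rw [Real.cosh_le_cosh, abs_of_pos hy0, abs_of_nonneg (by positivity)]
      nlinarith
    nlinarith
  have := hmono (mem_Ici.2 le_rfl) (mem_Ici.2 hx) hx
  simp at this
  linarith

theorem four_mul_sinh_sq (y : ℝ) :
    4 * Real.sinh y ^ 2 = Real.exp (2 * y) + (Real.exp (2 * y))⁻¹ - 2 := by
  have h1 : Real.exp (2 * y) = Real.exp y ^ 2 := by rw [← Real.exp_nat_mul]; norm_num
  have h2 := Real.exp_pos y
  rw [Real.sinh_eq, Real.exp_neg, h1]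
  field_simp
  ring

theorem two_sub_lam : 2 * (2 - lam) = 1 + 2 / Real.sqrt 3 := by
  unfold lam; ring

theorem one_lt_two_div_sqrt_three : 1 < 2 / Real.sqrt 3 := by
  have h3 : Real.sqrt 3 < 2 := by
    rw [Real.sqrt_lt' (by norm_num)]; norm_num
  rw [lt_div_iff₀ (by positivity)]; linarith

theorem lam_pos : 0 < lam := by
  have h3 : (1 : ℝ) < Real.sqrt 3 := by
    rw [Real.lt_sqrt (by norm_num)]; norm_num
  have : 1 / Real.sqrt 3 < 1 := by rw [div_lt_one (by linarith)]; exact h3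
  unfold lam; linarith

theorem lam_lt_one : lam < 1 := by
  have := two_sub_lam
  have := one_lt_two_div_sqrt_three
  linarith

/-- The discriminant inequality behind the operator norm bound for the derivatives of `T_j`. -/
theorem discriminant_bound {u : ℝ} (hu : 1 ≤ u) :
    u ^ 2 ≤ u ^ (2 * (2 - lam)) ∧
    (u - 1) ^ 2 * u ^ (2 * (2 - lam)) ≤
      3 * (u ^ (2 * (2 - lam)) - 1) * (u ^ (2 * (2 - lam)) - u ^ 2) := by
  have hu0 : 0 < u := by linarith
  have hlam := lam_lt_one
  constructor
  · rw [← Real.rpow_natCast]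
    apply Real.rpow_le_rpow_of_exponent_le hu
    push_cast; linarith
  set c : ℝ := 2 / Real.sqrt 3 with hc
  have hc1 : 1 < c := one_lt_two_div_sqrt_three
  have hc2 : c ^ 2 = 4 / 3 := by
    rw [hc, div_pow, Real.sq_sqrt (by norm_num)]; norm_num
  set R : ℝ := u ^ c with hR
  have hRpos : 0 < R := Real.rpow_pos_of_pos hu0 _
  have hΛ : u ^ (2 * (2 - lam)) = u * R := by
    rw [two_sub_lam, Real.rpow_add hu0, Real.rpow_one]
  rw [hΛ]
  set x : ℝ := Real.log u / 2 with hx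
  have hx0 : 0 ≤ x := div_nonneg (Real.log_nonneg hu) (by norm_num)
  have hux : Real.exp (2 * x) = u := by
    rw [hx, mul_div_cancel₀ _ (by norm_num), Real.exp_log hu0]
  have hRx : Real.exp (2 * (c * x)) = R := by
    rw [hR, Real.rpow_def_of_pos hu0, hx]; congr 1; ring
  have h1 := four_mul_sinh_sq x
  have h2 := four_mul_sinh_sq (c * x)
  rw [hux] at h1
  rw [hRx] at h2
  have hs := mul_sinh_le_sinh_mul hc1.le hx0
  have hs0 : 0 ≤ Real.sinh x := Real.sinh_nonneg_iff.2 hx0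
  have hsq : (c * Real.sinh x) ^ 2 ≤ Real.sinh (c * x) ^ 2 :=
    pow_le_pow_left₀ (by positivity) hs 2
  have key : 4 / 3 * (u + u⁻¹ - 2) ≤ R + R⁻¹ - 2 := by
    rw [← h1, ← h2]; rw [mul_pow, hc2] at hsq; linarith
  have e1 : 3 * (u * R - 1) * (u * R - u ^ 2) - (u - 1) ^ 2 * (u * R)
      = 3 * u ^ 2 * R * ((R + R⁻¹ - 2) - 4 / 3 * (u + u⁻¹ - 2)) := by
    field_simp; ring
  have : 0 ≤ 3 * u ^ 2 * R * ((R + R⁻¹ - 2) - 4 / 3 * (u + u⁻¹ - 2)) :=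
    mul_nonneg (by positivity) (by linarith)
  linarith

/-- A nonnegative quadratic form. -/
theorem quadratic_form_nonneg {A B C : ℝ} (hA : 0 ≤ A) (hC : 0 ≤ C) (h : B ^ 2 ≤ A * C)
    (p q : ℝ) : 0 ≤ A * p ^ 2 - 2 * B * p * q + C * q ^ 2 := by
  rcases hA.eq_or_lt with rfl | hA
  · have : B = 0 := by nlinarith
    subst this; nlinarith [mul_nonneg hC (sq_nonneg q)]
  · have h1 : 0 ≤ A * (A * p ^ 2 - 2 * B * p * q + C * q ^ 2) := by
      nlinarith [sq_nonneg (A * p - B * q), mul_nonneg (sub_nonneg.2 h) (sq_nonneg q)]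
    exact nonneg_of_mul_nonneg_right h1 hA

/-- On the plane `p + q + r = 0`, in the variables `p` and `e = q - r` and with `w = y - z`, twice
the difference of the two sides is `(3(Λ-1) - w²) p² - 2uw p e + (Λ - u²) e²`. Its discriminant
condition reads `w² Λ ≤ 3(Λ-1)(Λ-u²)` and is hardest at `|w| = u - 1`, the case of the hypothesis
`hΛ`. -/
theorem contraction_form {u Λ p q r y z : ℝ} (hu : 1 ≤ u) (hΛ2 : u ^ 2 ≤ Λ)
    (hΛ : (u - 1) ^ 2 * Λ ≤ 3 * (Λ - 1) * (Λ - u ^ 2))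
    (hsum : p + q + r = 0) (hyz : y + z = u - 1) (hy : 0 ≤ y) (hz : 0 ≤ z) :
    p ^ 2 + (u * q + p * y) ^ 2 + (u * r + p * z) ^ 2 ≤ Λ * (p ^ 2 + q ^ 2 + r ^ 2) := by
  have hw : (y - z) ^ 2 ≤ (u - 1) ^ 2 := by rw [← hyz]; nlinarith [mul_nonneg hy hz]
  have hΛ1 : 1 ≤ Λ := by nlinarith
  have hA : 0 ≤ 3 * (Λ - 1) - (y - z) ^ 2 := by
    by_contra hneg
    push Not at hneg
    have : (u - 1) ^ 2 * Λ ≤ (u - 1) ^ 2 * (Λ - u ^ 2) :=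
      hΛ.trans (mul_le_mul_of_nonneg_right (by linarith) (by linarith))
    have h2 : (u - 1) ^ 2 * u ^ 2 ≤ 0 := by linarith
    have h3 : (u - 1) ^ 2 = 0 := by
      have : 0 < u ^ 2 := by positivity
      nlinarith [sq_nonneg (u - 1)]
    nlinarith
  have hB : (u * (y - z)) ^ 2 ≤ (3 * (Λ - 1) - (y - z) ^ 2) * (Λ - u ^ 2) := by
    nlinarith [mul_le_mul_of_nonneg_right hw (by linarith : (0 : ℝ) ≤ Λ)]
  have := quadratic_form_nonneg hA (by linarith : 0 ≤ Λ - u ^ 2) hB p (q - r)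
  have hq : q = (-p + (q - r)) / 2 := by linarith
  have hr : r = (-p - (q - r)) / 2 := by linarith
  have hy' : y = (u - 1 + (y - z)) / 2 := by linarith
  have hz' : z = (u - 1 - (y - z)) / 2 := by linarith
  generalize q - r = e at *
  generalize y - z = w at *
  subst hq hr hy' hz'
  nlinarith

/-- Convexity of `x ↦ x ^ (-e)` on the positive reals. -/
theorem rpow_neg_convex {e x y α β : ℝ} (he : 0 ≤ e) (hx : 0 < x) (hy : 0 < y) (hα : 0 ≤ α)
    (hβ : 0 ≤ β) (hαβ : α + β = 1) :
    (α * x + β * y) ^ (-e) ≤ α * x ^ (-e) + β * y ^ (-e) := by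
  have h1 : x ^ α * y ^ β ≤ α * x + β * y :=
    Real.geom_mean_le_arith_mean2_weighted hα hβ hx.le hy.le hαβ
  have h2 : (x ^ (-e)) ^ α * (y ^ (-e)) ^ β ≤ α * x ^ (-e) + β * y ^ (-e) :=
    Real.geom_mean_le_arith_mean2_weighted hα hβ (by positivity) (by positivity) hαβ
  refine le_trans ?_ h2
  have h3 : (x ^ (-e)) ^ α * (y ^ (-e)) ^ β = (x ^ α * y ^ β) ^ (-e) := by
    rw [Real.mul_rpow (by positivity) (by positivity), ← Real.rpow_mul hx.le,
      ← Real.rpow_mul hy.le, ← Real.rpow_mul hx.le, ← Real.rpow_mul hy.le]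
    ring_nf
  rw [h3]
  exact Real.rpow_le_rpow_of_nonpos (by positivity) h1 (by linarith)

/-- If `p, q ≥ 0` and `p + q ≤ c` then moving all the mass to one summand increases the sum of
the values of the convex function `p ↦ (2 - p) ^ (-e)`. -/
theorem rpow_neg_add_le {e p q c : ℝ} (he : 0 ≤ e) (hp : 0 ≤ p) (hq : 0 ≤ q) (hpq : p + q ≤ c)
    (hc : c ≤ 1) :
    (2 - p) ^ (-e) + (2 - q) ^ (-e) ≤ (2 - c) ^ (-e) + 2 ^ (-e) := by
  have hc0 : 0 ≤ c := by linarith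
  have hmono : (2 : ℝ) ^ (-e) ≤ (2 - c) ^ (-e) :=
    Real.rpow_le_rpow_of_nonpos (by linarith) (by linarith) (by linarith)
  rcases hc0.eq_or_lt with rfl | hc0
  · have hp' : p = 0 := by linarith
    have hq' : q = 0 := by linarith
    simp [hp', hq']
  -- Both values lie below the chord over `[0, c]`; the fractions `p / c` and `q / c` add up to at
  -- most `1`.
  have chord : ∀ t, 0 ≤ t → t ≤ c →
      (2 - t) ^ (-e) ≤ 2 ^ (-e) + t / c * ((2 - c) ^ (-e) - 2 ^ (-e)) := by
    intro t ht htc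
    have h := rpow_neg_convex he (x := 2) (y := 2 - c) (α := 1 - t / c) (β := t / c)
      (by norm_num) (by linarith) (by rw [sub_nonneg, div_le_one hc0]; exact htc)
      (by positivity) (by ring)
    have e1 : (1 - t / c) * 2 + t / c * (2 - c) = 2 - t := by field_simp; ring
    rw [e1] at h
    linarith
  have h1 := chord p hp (by linarith)
  have h2 := chord q hq (by linarith)
  have h3 : p / c + q / c ≤ 1 := by rw [← add_div, div_le_one hc0]; exact hpq
  nlinarith

/-! ### The maps `T_j` on the simplex -/

theorem T_apply (j i : Fin 3) (x : E3) :
    T j x i = if i = j then 1 / (2 - x j) else x i / (2 - x j) := rfl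

theorem T_apply_self (j : Fin 3) (x : E3) : T j x j = 1 / (2 - x j) := by simp [T_apply]

theorem T_apply_of_ne {j i : Fin 3} (h : i ≠ j) (x : E3) : T j x i = x i / (2 - x j) := by
  simp [T_apply, h]

theorem simplex_sum_others {x : E3} (hx : x ∈ simplex) {i j k : Fin 3} (hij : i ≠ j)
    (hik : i ≠ k) (hjk : j ≠ k) : x i + x j + x k = 1 := by
  have h := hx.2
  rw [Fin.sum_univ_three] at h
  fin_cases i <;> fin_cases j <;> fin_cases k <;> simp_all <;> linarith

theorem simplex_le_one {x : E3} (hx : x ∈ simplex) (i : Fin 3) : x i ≤ 1 := by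
  rw [← hx.2]
  exact Finset.single_le_sum (fun j _ => hx.1 j) (Finset.mem_univ i)

theorem simplex_add_le_one {x : E3} (hx : x ∈ simplex) {i j : Fin 3} (hij : i ≠ j) :
    x i + x j ≤ 1 := by
  rw [← hx.2, ← Finset.sum_pair hij]
  exact Finset.sum_le_sum_of_subset_of_nonneg (Finset.subset_univ _) (fun k _ _ => hx.1 k)

theorem one_le_two_sub {x : E3} (hx : x ∈ simplex) (i : Fin 3) : 1 ≤ 2 - x i := by
  linarith [simplex_le_one hx i]

theorem T_mem_simplex (j : Fin 3) {x : E3} (hx : x ∈ simplex) : T j x ∈ simplex := by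
  have h := one_le_two_sub hx j
  refine ⟨fun i => ?_, ?_⟩
  · rw [T_apply]
    split_ifs
    · positivity
    · exact div_nonneg (hx.1 i) (by linarith)
  · have h0 : (2 - x j) ≠ 0 := by linarith
    have hs := hx.2
    rw [Fin.sum_univ_three] at hs ⊢
    simp only [T_apply]
    fin_cases j <;> simp at h0 ⊢ <;> field_simp <;> linarith

theorem T_injOn (j : Fin 3) : InjOn (T j) simplex := by
  intro x hx y hy hxy
  have h1 := one_le_two_sub hx j
  have h2 := one_le_two_sub hy j
  have hj : x j = y j := by
    have := congrArg (fun z : E3 => z j) hxy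
    simp only [T_apply_self] at this
    rw [div_eq_div_iff (by linarith) (by linarith)] at this
    linarith
  ext i
  by_cases hi : i = j
  · rw [hi, hj]
  · have := congrArg (fun z : E3 => z i) hxy
    simp only [T_apply_of_ne hi, hj] at this
    rwa [div_left_inj' (by linarith)] at this

theorem sq_dist_eq {j k l : Fin 3} (hjk : j ≠ k) (hjl : j ≠ l) (hkl : k ≠ l) (x y : E3) :
    dist x y ^ 2 = (x j - y j) ^ 2 + (x k - y k) ^ 2 + (x l - y l) ^ 2 := by
  rw [EuclideanSpace.dist_eq, Real.sq_sqrt (by positivity), Fin.sum_univ_three]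
  simp only [Real.dist_eq, sq_abs]
  fin_cases j <;> fin_cases k <;> fin_cases l <;> simp_all <;> ring

theorem exists_others (j : Fin 3) : ∃ k l : Fin 3, j ≠ k ∧ j ≠ l ∧ k ≠ l := by
  fin_cases j
  · exact ⟨1, 2, by decide, by decide, by decide⟩
  · exact ⟨0, 2, by decide, by decide, by decide⟩
  · exact ⟨0, 1, by decide, by decide, by decide⟩

/-- `T_j` contracts distances by the factor `(2 - x_j)^{-λ}`, in terms of a lower bound `c` for
`2 - x_j` at the two points. -/
theorem dist_T_le {j : Fin 3} {x y : E3} (hx : x ∈ simplex) (hy : y ∈ simplex) {c : ℝ}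
    (hc : 0 < c) (hcx : c ≤ 2 - x j) (hcy : c ≤ 2 - y j) :
    dist (T j x) (T j y) ≤ c ^ (-lam) * dist x y := by
  wlog hxy : x j ≤ y j generalizing x y
  · rw [dist_comm, dist_comm x]
    exact this hy hx hcy hcx (le_of_not_ge hxy)
  obtain ⟨k, l, hjk, hjl, hkl⟩ := exists_others j
  set u := 2 - y j with hu
  set t := 2 - x j with ht
  have hu1 : 1 ≤ u := one_le_two_sub hy j
  have htu : u ≤ t := by linarith
  have hu0 : 0 < u := by linarith
  have ht0 : 0 < t := by linarith
  have sx := simplex_sum_others hx hjk hjl hkl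
  have sy := simplex_sum_others hy hjk hjl hkl
  obtain ⟨hΛ2, hΛ⟩ := discriminant_bound hu1
  set Λ := u ^ (2 * (2 - lam)) with hΛdef
  have form := contraction_form (p := x j - y j) (q := x k - y k) (r := x l - y l)
    (y := y k) (z := y l) hu1 hΛ2 hΛ (by linarith) (by rw [hu]; linarith) (hy.1 k) (hy.1 l)
  rw [← sq_dist_eq hjk hjl hkl] at form
  -- After multiplication by `t u`, the difference of the images is linear in `x - y`, with
  -- coefficients depending on `y` alone.
  have hT : dist (T j x) (T j y) ^ 2 * (t * u) ^ 2 =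
      (x j - y j) ^ 2 + (u * (x k - y k) + (x j - y j) * y k) ^ 2 +
        (u * (x l - y l) + (x j - y j) * y l) ^ 2 := by
    rw [sq_dist_eq hjk hjl hkl, T_apply_self, T_apply_self, T_apply_of_ne hjk.symm,
      T_apply_of_ne hjk.symm, T_apply_of_ne hjl.symm, T_apply_of_ne hjl.symm, ← hu, ← ht]
    have e : x j - y j = u - t := by rw [hu, ht]; ring
    rw [e]
    field_simp
    ring
  rw [← hT] at form
  have hsq : Λ = (u ^ (2 - lam)) ^ 2 := by
    rw [hΛdef, ← Real.rpow_natCast, ← Real.rpow_mul hu0.le]; ring_nf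
  rw [hsq, ← mul_pow, ← mul_pow] at form
  have h1 := (pow_le_pow_iff_left₀ (by positivity) (by positivity) two_ne_zero).1 form
  have h2 : u ^ (2 - lam) = u * (u * u ^ (-lam)) := by
    rw [sub_eq_add_neg, Real.rpow_add hu0, Real.rpow_two]; ring
  -- The form gives `u^(2-λ)`, which is at most `t u · u^(-λ)` because `u ≤ t`; this is why `y` was
  -- taken with the larger coordinate.
  have h3 : dist (T j x) (T j y) * (t * u) ≤ (u ^ (-lam) * dist x y) * (t * u) := by
    refine h1.trans ?_
    rw [h2]
    have : 0 ≤ u ^ (-lam) * dist x y := by positivity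
    nlinarith [mul_le_mul_of_nonneg_left htu (mul_nonneg this hu0.le)]
  have h4 := le_of_mul_le_mul_right h3 (by positivity)
  refine h4.trans (mul_le_mul_of_nonneg_right ?_ dist_nonneg)
  exact Real.rpow_le_rpow_of_nonpos hc hcy (by linarith [lam_pos])

/-! ### Triples of vertices: determinant, longest side and cost -/

/-- The determinant of the matrix whose rows are the three vertices. -/
def vdet (X : Fin 3 → E3) : ℝ := Matrix.det (Matrix.of fun v i => X v i)

/-- The length of the longest side of the triangle with the given vertices. -/
def side (X : Fin 3 → E3) : ℝ := ⨆ p : Fin 3 × Fin 3, dist (X p.1) (X p.2)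

/-- The quantity `area^δ * diam^(1-δ)`, up to a constant factor. -/
def cost (δ : ℝ) (X : Fin 3 → E3) : ℝ := |vdet X| ^ δ * side X ^ (1 - δ)

theorem dist_le_side (X : Fin 3 → E3) (u v : Fin 3) : dist (X u) (X v) ≤ side X :=
  le_ciSup (f := fun p : Fin 3 × Fin 3 => dist (X p.1) (X p.2)) (finite_range _).bddAbove (u, v)

theorem side_nonneg (X : Fin 3 → E3) : 0 ≤ side X := dist_nonneg.trans (dist_le_side X 0 0)

theorem cost_nonneg (δ : ℝ) (X : Fin 3 → E3) : 0 ≤ cost δ X :=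
  mul_nonneg (Real.rpow_nonneg (abs_nonneg _) _) (Real.rpow_nonneg (side_nonneg X) _)

/-- On the plane of coordinate sum `1`, the vector `(2 - x_j) T_j x` is the image of `x` under the
linear map replacing `x_j` by the sum of the coordinates. That map has determinant `1`, so only the
scalings of the three rows matter. -/
theorem vdet_T (j : Fin 3) {X : Fin 3 → E3} (hX : ∀ v, X v ∈ simplex) :
    vdet (fun v => T j (X v)) * ((2 - X 0 j) * (2 - X 1 j) * (2 - X 2 j)) = vdet X := by
  have n0 : 2 - X 0 j ≠ 0 := by linarith [one_le_two_sub (hX 0) j]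
  have n1 : 2 - X 1 j ≠ 0 := by linarith [one_le_two_sub (hX 1) j]
  have n2 : 2 - X 2 j ≠ 0 := by linarith [one_le_two_sub (hX 2) j]
  have s0 := (hX 0).2
  have s1 := (hX 1).2
  have s2 := (hX 2).2
  rw [Fin.sum_univ_three] at s0 s1 s2
  simp only [vdet, Matrix.det_fin_three, Matrix.of_apply, T_apply]
  generalize X 0 = x at *
  generalize X 1 = y at *
  generalize X 2 = z at *
  fin_cases j <;> simp at n0 n1 n2 ⊢ <;> field_simp
  · rw [show x 0 = 1 - x 1 - x 2 by linarith, show y 0 = 1 - y 1 - y 2 by linarith,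
      show z 0 = 1 - z 1 - z 2 by linarith]; ring
  · rw [show x 1 = 1 - x 0 - x 2 by linarith, show y 1 = 1 - y 0 - y 2 by linarith,
      show z 1 = 1 - z 0 - z 2 by linarith]; ring
  · rw [show x 2 = 1 - x 0 - x 1 by linarith, show y 2 = 1 - y 0 - y 1 by linarith,
      show z 2 = 1 - z 0 - z 1 by linarith]; ring

theorem vdet_T_ne_zero (j : Fin 3) {X : Fin 3 → E3} (hX : ∀ v, X v ∈ simplex)
    (h : vdet X ≠ 0) : vdet (fun v => T j (X v)) ≠ 0 := by
  intro h0
  apply h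
  rw [← vdet_T j hX, h0, zero_mul]

theorem abs_vdet_T_rpow {j : Fin 3} {X : Fin 3 → E3} (hX : ∀ v, X v ∈ simplex) (δ : ℝ) :
    |vdet (fun v => T j (X v))| ^ δ =
      ((2 - X 0 j) ^ (-δ) * (2 - X 1 j) ^ (-δ) * (2 - X 2 j) ^ (-δ)) * |vdet X| ^ δ := by
  have n0 : 0 < 2 - X 0 j := by linarith [one_le_two_sub (hX 0) j]
  have n1 : 0 < 2 - X 1 j := by linarith [one_le_two_sub (hX 1) j]
  have n2 : 0 < 2 - X 2 j := by linarith [one_le_two_sub (hX 2) j]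
  rw [← vdet_T j hX, abs_mul, abs_of_pos (mul_pos (mul_pos n0 n1) n2),
    Real.mul_rpow (abs_nonneg _) (by positivity), Real.mul_rpow (by positivity) n2.le,
    Real.mul_rpow n0.le n1.le]
  have e : ∀ x : ℝ, 0 < x → x ^ (-δ) * x ^ δ = 1 := fun x hx => by
    rw [← Real.rpow_add hx, neg_add_cancel, Real.rpow_zero]
  have e0 := e _ n0
  have e1 := e _ n1
  have e2 := e _ n2
  generalize |vdet (fun v => T j (X v))| ^ δ = V
  symm
  calc _ = V * ((2 - X 0 j) ^ (-δ) * (2 - X 0 j) ^ δ) * ((2 - X 1 j) ^ (-δ) * (2 - X 1 j) ^ δ) *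
        ((2 - X 2 j) ^ (-δ) * (2 - X 2 j) ^ δ) := by ring
    _ = V := by rw [e0, e1, e2]; ring

theorem side_T_le {j : Fin 3} {X : Fin 3 → E3} (hX : ∀ v, X v ∈ simplex) {c : ℝ} (hc : 0 < c)
    (h : ∀ v, c ≤ 2 - X v j) : side (fun v => T j (X v)) ≤ c ^ (-lam) * side X := by
  refine ciSup_le fun p => ?_
  refine (dist_T_le (hX p.1) (hX p.2) hc (h _) (h _)).trans ?_
  exact mul_le_mul_of_nonneg_left (dist_le_side X _ _) (by positivity)

theorem side_T_rpow_le {δ : ℝ} (hδ1 : δ ≤ 1) {j : Fin 3} {X : Fin 3 → E3}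
    (hX : ∀ v, X v ∈ simplex) {c : ℝ} (hc : 0 < c) (h : ∀ v, c ≤ 2 - X v j) :
    side (fun v => T j (X v)) ^ (1 - δ) ≤ c ^ (-(lam * (1 - δ))) * side X ^ (1 - δ) := by
  refine (Real.rpow_le_rpow (side_nonneg _) (side_T_le hX hc h) (by linarith)).trans ?_
  rw [Real.mul_rpow (by positivity) (side_nonneg X), ← Real.rpow_mul hc.le, neg_mul]

theorem cost_T_le {δ : ℝ} (hδ0 : 0 ≤ δ) (hδ1 : δ ≤ 1) {j : Fin 3} {X : Fin 3 → E3}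
    (hX : ∀ v, X v ∈ simplex) {c : ℝ} (hc : 0 < c) (h : ∀ v, c ≤ 2 - X v j) :
    cost δ (fun v => T j (X v)) ≤ c ^ (-(3 * δ + lam * (1 - δ))) * cost δ X := by
  have h1 := side_T_rpow_le hδ1 hX hc h
  have h2 : ∀ v, (2 - X v j) ^ (-δ) ≤ c ^ (-δ) := fun v =>
    Real.rpow_le_rpow_of_nonpos hc (h v) (by linarith)
  have hn : ∀ v, 0 ≤ (2 - X v j) ^ (-δ) := fun v =>
    Real.rpow_nonneg (by linarith [one_le_two_sub (hX v) j]) _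
  have h3 : (2 - X 0 j) ^ (-δ) * (2 - X 1 j) ^ (-δ) * (2 - X 2 j) ^ (-δ) ≤
      c ^ (-δ) * c ^ (-δ) * c ^ (-δ) := by
    have := hn 0; have := hn 1; have := hn 2
    exact mul_le_mul (mul_le_mul (h2 0) (h2 1) (hn 1) (by positivity)) (h2 2) (hn 2)
      (by positivity)
  have h4 : c ^ (-(3 * δ + lam * (1 - δ))) =
      (c ^ (-δ) * c ^ (-δ) * c ^ (-δ)) * c ^ (-(lam * (1 - δ))) := by
    rw [← Real.rpow_add hc, ← Real.rpow_add hc, ← Real.rpow_add hc]; ring_nf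
  unfold cost
  rw [abs_vdet_T_rpow hX, h4]
  have hs := Real.rpow_nonneg (side_nonneg X) (1 - δ)
  have hs' := Real.rpow_nonneg (side_nonneg (fun v => T j (X v))) (1 - δ)
  calc _ ≤ (c ^ (-δ) * c ^ (-δ) * c ^ (-δ) * |vdet X| ^ δ) *
        (c ^ (-(lam * (1 - δ))) * side X ^ (1 - δ)) := by gcongr
    _ = _ := by ring

/-- The inequality of the means turns the product over the vertices into a sum, so that two letters
can be compared at each vertex separately by convexity. -/
theorem prod_rpow_neg_le {δ x y z : ℝ} (hx : 0 < x) (hy : 0 < y) (hz : 0 < z) :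
    x ^ (-δ) * y ^ (-δ) * z ^ (-δ) ≤
      1 / 3 * (x ^ (-(3 * δ)) + y ^ (-(3 * δ)) + z ^ (-(3 * δ))) := by
  have h := Real.geom_mean_le_arith_mean3_weighted (w₁ := 1 / 3) (w₂ := 1 / 3) (w₃ := 1 / 3)
    (p₁ := x ^ (-(3 * δ))) (p₂ := y ^ (-(3 * δ))) (p₃ := z ^ (-(3 * δ)))
    (by norm_num) (by norm_num) (by norm_num) (by positivity) (by positivity) (by positivity)
    (by norm_num)
  rw [← Real.rpow_mul hx.le, ← Real.rpow_mul hy.le, ← Real.rpow_mul hz.le,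
    show -(3 * δ) * (1 / 3) = -δ by ring] at h
  linarith

/-- The sum of the costs of two images of a triangle near the third corner. -/
theorem cost_T_add_le {δ : ℝ} (hδ0 : 0 ≤ δ) (hδ1 : δ ≤ 1) {j k : Fin 3} {X : Fin 3 → E3}
    (hX : ∀ v, X v ∈ simplex) {c : ℝ} (hc1 : c ≤ 1)
    (h : ∀ v, X v j + X v k ≤ c) :
    cost δ (fun v => T j (X v)) + cost δ (fun v => T k (X v)) ≤
      ((2 - c) ^ (-(3 * δ + lam * (1 - δ))) + 1 / 8 ^ δ * (2 - c) ^ (-(lam * (1 - δ)))) *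
        cost δ X := by
  have hc : 0 < 2 - c := by linarith
  have hj := side_T_rpow_le hδ1 (j := j) hX hc (fun v => by linarith [h v, (hX v).1 k])
  have hk := side_T_rpow_le hδ1 (j := k) hX hc (fun v => by linarith [h v, (hX v).1 j])
  have pj := prod_rpow_neg_le (δ := δ) (by linarith [one_le_two_sub (hX 0) j] : 0 < 2 - X 0 j)
    (by linarith [one_le_two_sub (hX 1) j] : 0 < 2 - X 1 j)
    (by linarith [one_le_two_sub (hX 2) j] : 0 < 2 - X 2 j)
  have pk := prod_rpow_neg_le (δ := δ) (by linarith [one_le_two_sub (hX 0) k] : 0 < 2 - X 0 k)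
    (by linarith [one_le_two_sub (hX 1) k] : 0 < 2 - X 1 k)
    (by linarith [one_le_two_sub (hX 2) k] : 0 < 2 - X 2 k)
  have conv := fun v => rpow_neg_add_le (e := 3 * δ) (by linarith) ((hX v).1 j) ((hX v).1 k) (h v) hc1
  have e8 : (2 : ℝ) ^ (-(3 * δ)) = 1 / 8 ^ δ := by
    rw [Real.rpow_neg (by norm_num), Real.rpow_mul (by norm_num), one_div]; norm_num
  have e1 : (2 - c) ^ (-(3 * δ + lam * (1 - δ))) =
      (2 - c) ^ (-(3 * δ)) * (2 - c) ^ (-(lam * (1 - δ))) := by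
    rw [← Real.rpow_add hc]; ring_nf
  have hsum : (2 - X 0 j) ^ (-δ) * (2 - X 1 j) ^ (-δ) * (2 - X 2 j) ^ (-δ) +
      (2 - X 0 k) ^ (-δ) * (2 - X 1 k) ^ (-δ) * (2 - X 2 k) ^ (-δ) ≤
      (2 - c) ^ (-(3 * δ)) + 1 / 8 ^ δ := by
    rw [← e8]
    linarith [conv 0, conv 1, conv 2]
  unfold cost
  rw [abs_vdet_T_rpow hX, abs_vdet_T_rpow hX, e1]
  have hd := Real.rpow_nonneg (abs_nonneg (vdet X)) δ
  have hs := Real.rpow_nonneg (side_nonneg X) (1 - δ)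
  have hn : ∀ v i, 0 ≤ (2 - X v i) ^ (-δ) := fun v i =>
    Real.rpow_nonneg (by linarith [one_le_two_sub (hX v) i]) _
  have := hn 0 j; have := hn 1 j; have := hn 2 j
  have := hn 0 k; have := hn 1 k; have := hn 2 k
  set P := (2 - X 0 j) ^ (-δ) * (2 - X 1 j) ^ (-δ) * (2 - X 2 j) ^ (-δ) with hP
  set R := (2 - X 0 k) ^ (-δ) * (2 - X 1 k) ^ (-δ) * (2 - X 2 k) ^ (-δ) with hR
  have hP0 : 0 ≤ P := by positivity
  have hR0 : 0 ≤ R := by positivity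
  set q := (2 - c) ^ (-(lam * (1 - δ))) with hq
  have hq0 : 0 ≤ q := by positivity
  calc _ ≤ P * |vdet X| ^ δ * (q * side X ^ (1 - δ)) +
        R * |vdet X| ^ δ * (q * side X ^ (1 - δ)) := by gcongr
    _ = (P + R) * (|vdet X| ^ δ * (q * side X ^ (1 - δ))) := by ring
    _ ≤ ((2 - c) ^ (-(3 * δ)) + 1 / 8 ^ δ) * (|vdet X| ^ δ * (q * side X ^ (1 - δ))) := by
        gcongr
    _ = _ := by ring

/-! ### Triangles as convex hulls, and their coverings -/

/-- The triangle with the given vertices. -/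
def hull (X : Fin 3 → E3) : Set E3 := {y | ∃ α ∈ simplex, y = ∑ v, α v • X v}

/-- `T_j` is projective: a convex combination with weights `α_v` goes to the one with weights
proportional to `α_v (2 - X_v j)`. -/
theorem T_image_hull_subset (j : Fin 3) {X : Fin 3 → E3} (hX : ∀ v, X v ∈ simplex) :
    T j '' hull X ⊆ hull (fun v => T j (X v)) := by
  rintro _ ⟨_, ⟨α, hα, rfl⟩, rfl⟩
  have hn : ∀ v, 1 ≤ 2 - X v j := fun v => one_le_two_sub (hX v) j
  set S : ℝ := ∑ v, α v * (2 - X v j) with hS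
  have hα1 := hα.2
  have hS1 : 1 ≤ S := by
    rw [hS, ← hα.2]
    exact Finset.sum_le_sum fun v _ => by nlinarith [hα.1 v, hn v]
  have hxj : 2 - (∑ v, α v • X v) j = S := by
    rw [hS]
    rw [Fin.sum_univ_three] at hα1 ⊢
    simp [Fin.sum_univ_three]
    linear_combination -2 * hα1
  refine ⟨WithLp.toLp 2 fun v => α v * (2 - X v j) / S, ⟨fun v => ?_, ?_⟩, ?_⟩
  · exact div_nonneg (mul_nonneg (hα.1 v) (by linarith [hn v])) (by linarith)
  · simp only [← Finset.sum_div]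
    exact div_self (by linarith)
  · have h0 := hn 0; have h1 := hn 1; have h2 := hn 2
    have n0 : 2 - X 0 j ≠ 0 := by linarith
    have n1 : 2 - X 1 j ≠ 0 := by linarith
    have n2 : 2 - X 2 j ≠ 0 := by linarith
    have nS : S ≠ 0 := by linarith
    ext i
    rw [T_apply, hxj]
    by_cases hi : i = j
    · subst hi
      simp only [Fin.sum_univ_three, if_true, PiLp.add_apply, PiLp.smul_apply, smul_eq_mul,
        T_apply_self]
      rw [Fin.sum_univ_three] at hα1
      field_simp
      linarith
    · simp only [Fin.sum_univ_three, if_neg hi, PiLp.add_apply, PiLp.smul_apply, smul_eq_mul,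
        T_apply_of_ne hi]
      field_simp

theorem exists_side_eq (X : Fin 3 → E3) (h : vdet X ≠ 0) :
    ∃ p q r : Fin 3, p ≠ q ∧ p ≠ r ∧ q ≠ r ∧ dist (X p) (X q) = side X := by
  obtain ⟨⟨p, q⟩, hpq⟩ := exists_eq_ciSup_of_finite
    (f := fun p : Fin 3 × Fin 3 => dist (X p.1) (X p.2))
  have hpq' : dist (X p) (X q) = side X := hpq
  have hne : p ≠ q := by
    rintro rfl
    rw [dist_self] at hpq'
    apply h
    have h01 : X 0 = X 1 := by
      rw [← dist_le_zero, hpq']; exact dist_le_side X 0 1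
    refine Matrix.det_zero_of_row_eq (i := 0) (j := 1) (by decide) ?_
    ext i; simp [h01]
  have : ∃ r, p ≠ r ∧ q ≠ r := by
    fin_cases p <;> fin_cases q <;> simp at hne ⊢ <;> decide
  obtain ⟨r, h1, h2⟩ := this
  exact ⟨p, q, r, hne, h1, h2, hpq'⟩

/-- Four times the squared area, as a Gram determinant, equals `3 * vdet ^ 2`. -/
theorem gram_eq {X : Fin 3 → E3} (hX : ∀ v, X v ∈ simplex) {p q r : Fin 3} (hpq : p ≠ q)
    (hpr : p ≠ r) (hqr : q ≠ r) :
    ‖X q - X p‖ ^ 2 * ‖X r - X p‖ ^ 2 - (inner ℝ (X q - X p) (X r - X p)) ^ 2 =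
      3 * vdet X ^ 2 := by
  have s0 := (hX 0).2
  have s1 := (hX 1).2
  have s2 := (hX 2).2
  rw [Fin.sum_univ_three] at s0 s1 s2
  rw [EuclideanSpace.real_norm_sq_eq, EuclideanSpace.real_norm_sq_eq, PiLp.inner_apply]
  simp only [vdet, Matrix.det_fin_three, Matrix.of_apply, Fin.sum_univ_three, PiLp.sub_apply,
    RCLike.inner_apply, conj_trivial]
  have hX0 : X 0 2 = 1 - X 0 0 - X 0 1 := by linarith
  have hX1 : X 1 2 = 1 - X 1 0 - X 1 1 := by linarith
  have hX2 : X 2 2 = 1 - X 2 0 - X 2 1 := by linarith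
  fin_cases p <;> fin_cases q <;> fin_cases r <;> simp at hpq hpr hqr <;>
    simp [hX0, hX1, hX2] <;> ring

theorem sum_perm {M : Type*} [AddCommMonoid M] (f : Fin 3 → M) {p q r : Fin 3} (hpq : p ≠ q)
    (hpr : p ≠ r) (hqr : q ≠ r) : ∑ v, f v = f p + f q + f r := by
  have h : (Finset.univ : Finset (Fin 3)) = {p, q, r} := by
    ext v; simp; omega
  rw [h, Finset.sum_insert (by simp [hpq, hpr]), Finset.sum_pair hqr, add_assoc]

set_option maxHeartbeats 800000 in
/-- A nondegenerate triangle with longest side `d` and height `h` is covered by at most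
`2 d / h` sets of diameter at most `2 h`; the `δ`-cost is comparable with the resulting sum. -/
theorem exists_cover {δ : ℝ} (hδ0 : 0 ≤ δ) {X : Fin 3 → E3}
    (hX : ∀ v, X v ∈ simplex) (hdet : vdet X ≠ 0) :
    ∃ (N : ℕ) (P : Fin N → Set E3), hull X ⊆ ⋃ i, P i ∧
      ∑ i, Metric.ediam (P i) ^ (1 + δ) ≤
        ENNReal.ofReal (2 * 2 ^ (1 + δ) * Real.sqrt 3 ^ δ * cost δ X) := by
  obtain ⟨p, q, r, hpq, hpr, hqr, hside⟩ := exists_side_eq X hdet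
  set d := side X with hd
  set U := X q - X p with hU
  set W := X r - X p with hW
  have hgram := gram_eq hX hpq hpr hqr
  rw [← hU, ← hW] at hgram
  have hUd : ‖U‖ = d := by rw [← hside, dist_comm, dist_eq_norm]
  have hWd : ‖W‖ ≤ d := by rw [hW, ← dist_eq_norm]; exact dist_le_side X r p
  have hUWd : ‖W - U‖ ≤ d := by
    rw [hU, hW, sub_sub_sub_cancel_right, ← dist_eq_norm]; exact dist_le_side X r q
  set g : ℝ := inner ℝ U W with hg
  have hdet2 : 0 < vdet X ^ 2 := by positivity
  have hd0 : 0 < d := by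
    rcases (side_nonneg X).eq_or_lt with h | h
    · rw [hUd, hd, ← h] at hgram; nlinarith [sq_nonneg g]
    · exact h
  -- `X p + t U` is the foot of the altitude onto the longest side and `n` is the altitude vector;
  -- the foot lies on that side, so `0 ≤ t ≤ 1`.
  set t := g / d ^ 2 with ht
  set n := W - t • U with hn
  have hnorm : ‖W - U‖ ^ 2 = ‖W‖ ^ 2 - 2 * g + ‖U‖ ^ 2 := by
    rw [norm_sub_sq_real, real_inner_comm]
  have hg0 : 0 ≤ g := by
    have : ‖W - U‖ ^ 2 ≤ d ^ 2 := pow_le_pow_left₀ (norm_nonneg _) hUWd 2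
    rw [hUd] at hnorm
    linarith [sq_nonneg ‖W‖]
  have hg1 : g ≤ d ^ 2 := by
    have := real_inner_le_norm U W
    rw [hUd] at this
    rw [sq]; exact this.trans (mul_le_mul_of_nonneg_left hWd hd0.le)
  have ht0 : 0 ≤ t := by positivity
  have ht1 : t ≤ 1 := by rw [ht, div_le_one (by positivity)]; exact hg1
  have hnsq : (d * ‖n‖) ^ 2 = 3 * vdet X ^ 2 := by
    rw [← hgram, mul_pow, hn, norm_sub_sq_real, norm_smul, mul_pow, inner_smul_right,
      real_inner_comm, hUd, ← hg, Real.norm_eq_abs, sq_abs, ht]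
    field_simp; ring
  set h := ‖n‖ with hh
  have hh0 : 0 < h := by
    rcases (norm_nonneg n).eq_or_lt with h' | h'
    · rw [hh, ← h'] at hnsq; nlinarith
    · exact h'
  have hdh : d * h = Real.sqrt 3 * |vdet X| := by
    rw [← Real.sqrt_sq (by positivity : 0 ≤ d * h), hnsq, Real.sqrt_mul (by norm_num),
      Real.sqrt_sq_eq_abs]
  have hhd : h ≤ d := by
    have h1 : h ^ 2 = ‖W‖ ^ 2 - g ^ 2 / d ^ 2 := by
      have := hgram.trans hnsq.symm
      rw [hUd] at this
      field_simp; linarith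
    have h2 : 0 ≤ g ^ 2 / d ^ 2 := by positivity
    have h4 : ‖W‖ ^ 2 ≤ d ^ 2 := pow_le_pow_left₀ (norm_nonneg _) hWd 2
    have h3 : h ^ 2 ≤ d ^ 2 := by linarith
    exact (pow_le_pow_iff_left₀ hh0.le hd0.le two_ne_zero).1 h3
  set N := ⌈d / h⌉₊ with hN
  have hN1 : d / h ≤ N := Nat.le_ceil _
  have hN0 : 0 < (N : ℝ) := lt_of_lt_of_le (by positivity) hN1
  have hN2 : (N : ℝ) ≤ 2 * d / h := by
    have := Nat.ceil_lt_add_one (by positivity : 0 ≤ d / h)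
    have h1 : 1 ≤ d / h := by rw [le_div_iff₀ hh0]; linarith
    rw [mul_div_assoc]; linarith
  have hdN : d / N ≤ h := by
    rw [div_le_iff₀ hN0]; rw [div_le_iff₀ hh0] at hN1; linarith
  -- The rectangle over the longest side with height `h` is cut into `N = ⌈d / h⌉` slices of width
  -- `d / N ≤ h`.
  refine ⟨N, fun i => {y | ∃ x z : ℝ, (i : ℝ) / N ≤ x ∧ x ≤ ((i : ℝ) + 1) / N ∧ 0 ≤ z ∧ z ≤ 1 ∧
    y = X p + x • U + z • n}, ?_, ?_⟩
  · rintro _ ⟨α, hα, rfl⟩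
    have hα1 := hα.2
    rw [sum_perm _ hpq hpr hqr] at hα1
    have hq0 := hα.1 q
    have hr0 := hα.1 r
    have hp0 := hα.1 p
    set x := α q + α r * t with hx
    have hx0 : 0 ≤ x := by positivity
    have hx1 : x ≤ 1 := by
      have := mul_le_mul_of_nonneg_left ht1 hr0
      linarith
    have heq : ∑ v, α v • X v = X p + x • U + α r • n := by
      rw [sum_perm _ hpq hpr hqr, show α p = 1 - α q - α r by linarith, hn, hU, hW, hx]
      module
    rw [mem_iUnion]
    have hNn : 0 < N := by exact_mod_cast hN0
    -- The endpoint `x = 1` belongs to the last slice, since `⌊x N⌋` would be out of range there.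
    rcases hx1.eq_or_lt with hx1 | hx1
    · refine ⟨⟨N - 1, by omega⟩, x, α r, ?_, ?_, hr0, by linarith, heq⟩
      · rw [hx1, div_le_one hN0, Nat.cast_le]; omega
      · have : ((N - 1 : ℕ) : ℝ) + 1 = N := by
          rw [Nat.cast_sub hNn]; simp
        simp only [this, hx1]
        rw [div_self hN0.ne']
    · have hfl : ⌊x * N⌋₊ < N := by
        rw [Nat.floor_lt (by positivity)]; exact mul_lt_of_lt_one_left hN0 hx1
      refine ⟨⟨⌊x * N⌋₊, hfl⟩, x, α r, ?_, ?_, hr0, by linarith, heq⟩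
      · rw [div_le_iff₀ hN0]; exact Nat.floor_le (by positivity)
      · rw [le_div_iff₀ hN0]; exact (Nat.lt_floor_add_one _).le
  · have hdiam : ∀ i : Fin N, Metric.ediam {y : E3 | ∃ x z : ℝ, (i : ℝ) / N ≤ x ∧
        x ≤ ((i : ℝ) + 1) / N ∧ 0 ≤ z ∧ z ≤ 1 ∧ y = X p + x • U + z • n} ≤
        ENNReal.ofReal (2 * h) := by
      intro i
      refine Metric.ediam_le ?_
      rintro _ ⟨x, z, hx1, hx2, hz1, hz2, rfl⟩ _ ⟨x', z', hx1', hx2', hz1', hz2', rfl⟩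
      rw [edist_dist]
      apply ENNReal.ofReal_le_ofReal
      rw [dist_eq_norm, show X p + x • U + z • n - (X p + x' • U + z' • n) =
        (x - x') • U + (z - z') • n by module]
      refine (norm_add_le _ _).trans ?_
      rw [norm_smul, norm_smul, hUd, ← hh, Real.norm_eq_abs, Real.norm_eq_abs]
      have e1 : |x - x'| ≤ 1 / N := by
        rw [add_div] at hx2 hx2'
        rw [abs_le]; constructor <;> linarith
      have e2 : |z - z'| ≤ 1 := by rw [abs_le]; constructor <;> linarith
      calc |x - x'| * d + |z - z'| * h ≤ 1 / N * d + 1 * h := by gcongr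
        _ ≤ 2 * h := by rw [one_div_mul_eq_div]; linarith
    calc _ ≤ ∑ _i : Fin N, ENNReal.ofReal ((2 * h) ^ (1 + δ)) := by
          refine Finset.sum_le_sum fun i _ => ?_
          rw [← ENNReal.ofReal_rpow_of_pos (by positivity)]
          exact ENNReal.rpow_le_rpow (hdiam i) (by linarith)
      _ = ENNReal.ofReal (N * (2 * h) ^ (1 + δ)) := by
          rw [Finset.sum_const, Finset.card_univ, Fintype.card_fin, nsmul_eq_mul,
            ENNReal.ofReal_mul (by positivity), ENNReal.ofReal_natCast]
      _ ≤ _ := by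
          apply ENNReal.ofReal_le_ofReal
          unfold cost
          have e1 : Real.sqrt 3 ^ δ * |vdet X| ^ δ = d ^ δ * h ^ δ := by
            rw [← Real.mul_rpow (by positivity) (by positivity), ← hdh,
              Real.mul_rpow hd0.le hh0.le]
          have e2 : d ^ δ * d ^ (1 - δ) = d := by
            rw [← Real.rpow_add hd0]; simp
          have e3 : (2 * h) ^ (1 + δ) = 2 ^ (1 + δ) * (h * h ^ δ) := by
            rw [Real.mul_rpow (by norm_num) hh0.le, Real.rpow_add hh0 1 δ, Real.rpow_one]
          have e4 : 2 * 2 ^ (1 + δ) * Real.sqrt 3 ^ δ * (|vdet X| ^ δ * d ^ (1 - δ)) =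
              2 * d / h * (2 ^ (1 + δ) * (h * h ^ δ)) := by
            calc _ = 2 * 2 ^ (1 + δ) * (Real.sqrt 3 ^ δ * |vdet X| ^ δ) * d ^ (1 - δ) := by ring
              _ = 2 * 2 ^ (1 + δ) * (d ^ δ * d ^ (1 - δ)) * h ^ δ := by rw [e1]; ring
              _ = _ := by rw [e2]; field_simp
          rw [← hd, e4, e3]
          gcongr

/-! ### Cylinders -/

/-- The image of the simplex under the map associated with a word. -/
def cyl (l : List (Fin 3)) : Set E3 := wordMap l '' simplex

theorem wordMap_nil (x : E3) : wordMap [] x = x := rfl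

theorem wordMap_cons (j : Fin 3) (l : List (Fin 3)) (x : E3) :
    wordMap (j :: l) x = T j (wordMap l x) := rfl

theorem wordMap_append (l l' : List (Fin 3)) (x : E3) :
    wordMap (l ++ l') x = wordMap l (wordMap l' x) := by
  simp [wordMap, List.foldr_append]

theorem wordMap_mem_simplex (l : List (Fin 3)) {x : E3} (hx : x ∈ simplex) :
    wordMap l x ∈ simplex := by
  induction l with
  | nil => exact hx
  | cons j l ih => exact T_mem_simplex j ih

theorem cyl_subset_simplex (l : List (Fin 3)) : cyl l ⊆ simplex := by
  rintro _ ⟨x, hx, rfl⟩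
  exact wordMap_mem_simplex l hx

theorem wordMap_injOn (l : List (Fin 3)) : InjOn (wordMap l) simplex := by
  induction l with
  | nil => exact injOn_id _
  | cons j l ih =>
    intro x hx y hy hxy
    exact ih hx hy (T_injOn j (wordMap_mem_simplex l hx) (wordMap_mem_simplex l hy) hxy)

theorem cyl_append (l l' : List (Fin 3)) : cyl (l ++ l') = wordMap l '' cyl l' := by
  unfold cyl
  rw [image_image]
  simp only [wordMap_append]

theorem cyl_cons (j : Fin 3) (l : List (Fin 3)) : cyl (j :: l) = T j '' cyl l :=
  cyl_append [j] l

theorem cyl_subset_of_prefix {l l' : List (Fin 3)} (h : l <+: l') : cyl l' ⊆ cyl l := by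
  obtain ⟨r, rfl⟩ := h
  rw [cyl_append]
  exact image_mono (cyl_subset_simplex r)

theorem isCompact_simplex : IsCompact simplex := by
  have : simplex = WithLp.toLp 2 '' stdSimplex ℝ (Fin 3) := by
    ext x
    constructor
    · intro hx
      exact ⟨x.ofLp, ⟨hx.1, hx.2⟩, rfl⟩
    · rintro ⟨y, hy, rfl⟩
      exact ⟨hy.1, hy.2⟩
  rw [this]
  exact (isCompact_stdSimplex ℝ (Fin 3)).image (PiLp.continuous_toLp 2 _)

theorem continuousOn_T (j : Fin 3) : ContinuousOn (T j) simplex := by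
  have hc : ∀ i : Fin 3, ContinuousOn (fun x : E3 => x i) simplex := fun i =>
    (EuclideanSpace.proj i).continuous.continuousOn
  refine (PiLp.continuous_toLp 2 _).comp_continuousOn ?_
  refine continuousOn_pi.2 fun i => ?_
  have hne : ∀ x ∈ simplex, 2 - x j ≠ 0 := fun x hx => by linarith [one_le_two_sub hx j]
  by_cases hi : i = j
  · simp only [hi, if_true]
    exact continuousOn_const.div (continuousOn_const.sub (hc j)) hne
  · simp only [hi, if_false]
    exact (hc i).div (continuousOn_const.sub (hc j)) hne

theorem isCompact_cyl (l : List (Fin 3)) : IsCompact (cyl l) := by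
  induction l with
  | nil =>
    rw [show cyl [] = simplex from image_id simplex]
    exact isCompact_simplex
  | cons j l ih =>
    rw [cyl_cons]
    exact ih.image_of_continuousOn ((continuousOn_T j).mono (cyl_subset_simplex l))

/-! ### The points with a coding -/

/-- The points of the simplex that have an infinite coding. -/
def coded : Set E3 :=
  {x | ∃ c : ℕ → Fin 3, ∀ n, x ∈ cyl (List.ofFn fun i : Fin n => c i)}

/-- The space of codes is compact, so projecting it away is a closed map; membership in the `n`-th
cylinder involves only finitely many letters. -/
theorem isClosed_coded : IsClosed coded := by
  have h : coded = Prod.snd '' {p : (ℕ → Fin 3) × E3 |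
      ∀ n, p.2 ∈ cyl (List.ofFn fun i : Fin n => p.1 i)} := by
    ext x
    constructor
    · rintro ⟨c, hc⟩
      exact ⟨(c, x), hc, rfl⟩
    · rintro ⟨⟨c, y⟩, hc, rfl⟩
      exact ⟨c, hc⟩
  rw [h]
  refine isClosedMap_snd_of_compactSpace _ ?_
  rw [ofPred_forall]
  refine isClosed_iInter fun n => ?_
  rw [← isOpen_compl_iff]
  have : {p : (ℕ → Fin 3) × E3 | p.2 ∈ cyl (List.ofFn fun i : Fin n => p.1 i)}ᶜ =
      ⋃ u : Fin n → Fin 3, ((fun c : ℕ → Fin 3 => fun i : Fin n => c i) ⁻¹' {u}) ×ˢ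
        (cyl (List.ofFn u))ᶜ := by
    ext ⟨c, x⟩
    simp
  rw [this]
  refine isOpen_iUnion fun u => IsOpen.prod ?_ (isCompact_cyl _).isClosed.isOpen_compl
  exact (isOpen_discrete _).preimage (by fun_prop)

/-- The vertices of the simplex. -/
def vertex (v : Fin 3) : E3 := EuclideanSpace.single v 1

theorem vertex_mem (v : Fin 3) : vertex v ∈ simplex := by
  refine ⟨fun i => ?_, ?_⟩
  · simp only [vertex, PiLp.single_apply]; split_ifs <;> norm_num
  · simp [vertex]

theorem T_vertex (v : Fin 3) : T v (vertex v) = vertex v := by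
  ext i
  rw [T_apply]
  by_cases h : i = v
  · simp [vertex, h]; norm_num
  · simp [vertex, h]

theorem eq_vertex_of_one_le {x : E3} (hx : x ∈ simplex) {v : Fin 3} (h : 1 ≤ x v) :
    x = vertex v := by
  ext i
  by_cases hi : i = v
  · subst hi
    simp [vertex, le_antisymm (simplex_le_one hx i) h]
  · have := simplex_add_le_one hx hi
    have := hx.1 i
    simp [vertex, hi]
    linarith

theorem coded_eq : coded = ⋃ j, T j '' coded := by
  ext x
  simp only [mem_iUnion]
  constructor
  · rintro ⟨c, hc⟩
    have h1 : ∀ n, ∃ y ∈ cyl (List.ofFn fun i : Fin n => c (i + 1)), T (c 0) y = x := by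
      intro n
      have := hc (n + 1)
      rw [List.ofFn_succ, cyl_cons] at this
      simpa using this
    obtain ⟨y, hy, hyx⟩ := h1 0
    refine ⟨c 0, y, ⟨fun n => c (n + 1), fun n => ?_⟩, hyx⟩
    -- Each `n` provides its own preimage; injectivity of `T` makes them all coincide.
    obtain ⟨z, hz, hzx⟩ := h1 n
    have : y = z := T_injOn (c 0) (cyl_subset_simplex _ hy) (cyl_subset_simplex _ hz)
      (hyx.trans hzx.symm)
    rw [this]
    exact hz
  · rintro ⟨j, y, ⟨c, hc⟩, rfl⟩
    refine ⟨fun n => Nat.casesOn n j c, fun n => ?_⟩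
    cases n with
    | zero => simpa [cyl, wordMap_nil] using T_mem_simplex j (cyl_subset_simplex _ (hc 0))
    | succ n =>
      rw [List.ofFn_succ, cyl_cons]
      exact ⟨y, by simpa using hc n, by simp⟩

theorem wordMap_replicate_vertex (v : Fin 3) (n : ℕ) :
    wordMap (List.replicate n v) (vertex v) = vertex v := by
  induction n with
  | zero => rfl
  | succ n ih => rw [List.replicate_succ, wordMap_cons, ih, T_vertex]

theorem coded_subset_simplex : coded ⊆ simplex := by
  rintro x ⟨c, hc⟩
  exact cyl_subset_simplex _ (hc 0)

/-- This inclusion suffices for an upper bound on the dimension. -/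
theorem gasket_subset_coded : gasket ⊆ coded := by
  refine sInter_subset_of_mem ⟨coded_subset_simplex, isClosed_coded, ?_, coded_eq⟩
  refine ⟨vertex 0, fun _ => 0, fun n => ?_⟩
  rw [List.ofFn_const]
  exact ⟨vertex 0, vertex_mem 0, wordMap_replicate_vertex 0 n⟩

/-- The gasket is contained in a plane. -/
theorem dimH_gasket_le_two : dimH gasket ≤ 2 := by
  let f : EuclideanSpace ℝ (Fin 2) → E3 := fun x => WithLp.toLp 2 ![x 0, x 1, 1 - x 0 - x 1]
  have hf : ContDiff ℝ 1 f := by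
    refine contDiff_euclidean.2 ?_
    have h : ∀ i : Fin 2, ContDiff ℝ 1 fun x : EuclideanSpace ℝ (Fin 2) => x i := fun i =>
      (EuclideanSpace.proj i : EuclideanSpace ℝ (Fin 2) →L[ℝ] ℝ).contDiff
    intro i
    fin_cases i
    · exact h 0
    · exact h 1
    · exact (contDiff_const.sub (h 0)).sub (h 1)
  have hsub : gasket ⊆ range f := by
    intro x hx
    have hx' := coded_subset_simplex (gasket_subset_coded hx)
    refine ⟨WithLp.toLp 2 ![x 0, x 1], ?_⟩
    have h := hx'.2
    rw [Fin.sum_univ_three] at h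
    ext i
    fin_cases i
    · simp [f]
    · simp [f]
    · simp [f]; linarith
  refine (dimH_mono hsub).trans (hf.dimH_range_le.trans ?_)
  simp

/-! ### Corners -/

/-- `T_a` acts on the coordinate `a` by the increasing map `s ↦ 1 / (2 - s)`, and `k / (k + 1)` is
the orbit of `0`. -/
theorem le_coord_of_mem_cyl_replicate {k : ℕ} {a : Fin 3} {x : E3}
    (hx : x ∈ cyl (List.replicate k a)) : (k : ℝ) / (k + 1) ≤ x a := by
  induction k generalizing x with
  | zero =>
    obtain ⟨y, hy, rfl⟩ := hx
    simpa [wordMap_nil] using hy.1 a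
  | succ k ih =>
    rw [List.replicate_succ, cyl_cons] at hx
    obtain ⟨y, hy, rfl⟩ := hx
    have h := ih hy
    have h1 := one_le_two_sub (cyl_subset_simplex _ hy) a
    rw [T_apply_self, div_le_div_iff₀ (by positivity) (by linarith)]
    rw [div_le_iff₀ (by positivity)] at h
    push_cast
    nlinarith

/-- After `T_b` the coordinate `a` is at most `1/2`, and `(k + 1) / (k + 2)` is the orbit of `1/2`
under `s ↦ 1 / (2 - s)`. -/
theorem coord_le_of_mem_cyl_replicate_append {k : ℕ} {a b : Fin 3} (hab : a ≠ b) {x : E3}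
    (hx : x ∈ cyl (List.replicate k a ++ [b])) : x a ≤ ((k : ℝ) + 1) / (k + 2) := by
  induction k generalizing x with
  | zero =>
    obtain ⟨y, hy, rfl⟩ := hx
    have h1 := one_le_two_sub hy b
    have h2 := simplex_add_le_one hy hab
    have h3 := simplex_le_one hy a
    simp only [List.replicate_zero, List.nil_append, wordMap_cons, wordMap_nil]
    rw [T_apply_of_ne hab, div_le_div_iff₀ (by linarith) (by norm_num)]
    push_cast
    linarith
  | succ k ih =>
    rw [List.replicate_succ, List.cons_append, cyl_cons] at hx
    obtain ⟨y, hy, rfl⟩ := hx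
    have h := ih hy
    have h1 := one_le_two_sub (cyl_subset_simplex _ hy) a
    rw [T_apply_self, div_le_div_iff₀ (by linarith) (by positivity)]
    rw [le_div_iff₀ (by positivity)] at h
    push_cast
    nlinarith

/-! ### Coverings by sets that contain each point infinitely often -/

/-- Borel–Cantelli: after deleting finitely many pieces the rest still covers `A`, and the tails of
the series tend to zero. A tail also bounds each single term, so its `s`-th root bounds the
diameters. -/
theorem dimH_le_of_infinite_cover {Y : Type*} [EMetricSpace Y] {ι : Type*} [Countable ι]
    {s : NNReal} (hs : 0 < s) (P : ι → Set Y)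
    (hsum : ∑' i, Metric.ediam (P i) ^ (s : ℝ) ≠ ⊤) {A : Set Y}
    (hA : ∀ x ∈ A, {i | x ∈ P i}.Infinite) : dimH A ≤ s := by
  classical
  borelize Y
  apply dimH_le_of_hausdorffMeasure_ne_top
  have hs' : (0 : ℝ) < s := hs
  have htail := ENNReal.tendsto_tsum_compl_atTop_zero hsum
  let t : Finset ι → ι → Set Y := fun F i => if i ∈ F then ∅ else P i
  have ht : ∀ F i, Metric.ediam (t F i) ^ (s : ℝ) =
      if i ∈ F then 0 else Metric.ediam (P i) ^ (s : ℝ) := by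
    intro F i
    by_cases h : i ∈ F <;> simp [t, h, hs']
  have hsumt : ∀ F, ∑' i, Metric.ediam (t F i) ^ (s : ℝ) =
      ∑' i : {i // i ∉ F}, Metric.ediam (P i) ^ (s : ℝ) := by
    intro F
    have := tsum_subtype {i | i ∉ F} (fun i => Metric.ediam (P i) ^ (s : ℝ))
    refine Eq.trans ?_ this.symm
    refine tsum_congr fun i => ?_
    rw [ht]
    by_cases h : i ∈ F <;> simp [h, indicator]
  have hle := MeasureTheory.Measure.hausdorffMeasure_le_liminf_tsum (s : ℝ) A (l := atTop)
    (fun F => (∑' i : {i // i ∉ F}, Metric.ediam (P i) ^ (s : ℝ)) ^ (s : ℝ)⁻¹)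
    (by
      have := (ENNReal.continuous_rpow_const (y := (s : ℝ)⁻¹)).tendsto 0 |>.comp htail
      rw [ENNReal.zero_rpow_of_pos (by positivity)] at this
      exact this) t
    (Eventually.of_forall fun F i => by
      rw [← hsumt, ENNReal.le_rpow_inv_iff hs']
      exact ENNReal.le_tsum (f := fun i => Metric.ediam (t F i) ^ (s : ℝ)) i)
    (Eventually.of_forall fun F x hx => by
      obtain ⟨i, hi, hiF⟩ := (hA x hx).exists_notMem_finset F
      refine mem_iUnion.2 ⟨i, ?_⟩
      simp only [t, hiF, if_false]
      exact hi)
  simp only [hsumt] at hle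
  rw [htail.liminf_eq] at hle
  exact ne_top_of_le_ne_top ENNReal.zero_ne_top hle

theorem wordMap_image_hull_subset (l : List (Fin 3)) {X : Fin 3 → E3}
    (hX : ∀ v, X v ∈ simplex) : wordMap l '' hull X ⊆ hull (fun v => wordMap l (X v)) := by
  induction l with
  | nil => rintro _ ⟨x, hx, rfl⟩; exact hx
  | cons j l ih =>
    rintro _ ⟨x, hx, rfl⟩
    exact T_image_hull_subset j (fun v => wordMap_mem_simplex l (hX v)) ⟨_, ih ⟨x, hx, rfl⟩, rfl⟩

theorem simplex_subset_hull_vertex : simplex ⊆ hull vertex := by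
  intro x hx
  refine ⟨x, hx, ?_⟩
  ext i
  simp [vertex, Fin.sum_univ_three]
  fin_cases i <;> simp

theorem vdet_vertex : vdet vertex ≠ 0 := by
  simp [vdet, Matrix.det_fin_three, vertex]

theorem vdet_wordMap_ne_zero (l : List (Fin 3)) {X : Fin 3 → E3} (hX : ∀ v, X v ∈ simplex)
    (h : vdet X ≠ 0) : vdet (fun v => wordMap l (X v)) ≠ 0 := by
  induction l with
  | nil => exact h
  | cons j l ih => exact vdet_T_ne_zero j (fun v => wordMap_mem_simplex l (hX v)) ih

/-- The points with an eventually constant coding form a countable set. -/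
theorem mem_range_of_eventually_const {x : E3} {c : ℕ → Fin 3}
    (hc : ∀ n, x ∈ cyl (List.ofFn fun i : Fin n => c i)) {N : ℕ}
    (hN : ∀ n, N ≤ n → c n = c (n + 1)) :
    x ∈ range fun p : List (Fin 3) × Fin 3 => wordMap p.1 (vertex p.2) := by
  have hconst : ∀ n, c (N + n) = c N := by
    intro n
    induction n with
    | zero => rfl
    | succ n ih => rw [← ih, ← add_assoc, ← hN _ (by omega)]
  set p := List.ofFn fun i : Fin N => c i with hp
  have h1 : ∀ n, ∃ y ∈ cyl (List.replicate n (c N)), wordMap p y = x := by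
    intro n
    have := hc (N + n)
    rw [List.ofFn_add] at this
    simp only [Fin.val_castLE, Fin.val_natAdd, hconst, List.ofFn_const] at this
    rw [cyl_append] at this
    exact this
  obtain ⟨y, hy, hyx⟩ := h1 0
  refine ⟨(p, c N), ?_⟩
  have hy' := cyl_subset_simplex _ hy
  have hle : ∀ n : ℕ, (n : ℝ) / (n + 1) ≤ y (c N) := by
    intro n
    obtain ⟨z, hz, hzx⟩ := h1 n
    rw [wordMap_injOn p hy' (cyl_subset_simplex _ hz) (hyx.trans hzx.symm)]
    exact le_coord_of_mem_cyl_replicate hz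
  have h2 : 1 ≤ y (c N) :=
    le_of_tendsto (tendsto_natCast_div_add_atTop (1 : ℝ)) (Eventually.of_forall hle)
  change wordMap p (vertex (c N)) = x
  rw [← eq_vertex_of_one_le hy' h2]
  exact hyx

/-- If the costs of all images of certain base triangles are summable then the gasket has
dimension at most `1 + δ`. -/
theorem dimH_gasket_le_of_summable {δ : ℝ} (hδ0 : 0 ≤ δ) {m : ℕ} (hm : 2 ≤ m)
    (h : ∀ u : Fin (m + 1) → Fin 3, u ⟨0, by omega⟩ ≠ u ⟨1, by omega⟩ →
      ∑' q : List (Fin 3), ENNReal.ofReal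
        (cost δ fun v => wordMap q.reverse (wordMap (List.ofFn u) (vertex v))) ≠ ⊤) :
    dimH gasket ≤ ENNReal.ofReal (1 + δ) := by
  let U := {u : Fin (m + 1) → Fin 3 // u ⟨0, by omega⟩ ≠ u ⟨1, by omega⟩}
  let X : U × List (Fin 3) → Fin 3 → E3 := fun p v =>
    wordMap p.2.reverse (wordMap (List.ofFn p.1.1) (vertex v))
  have hX : ∀ p v, X p v ∈ simplex := fun p v =>
    wordMap_mem_simplex _ (wordMap_mem_simplex _ (vertex_mem v))
  have hdet : ∀ p, vdet (X p) ≠ 0 := fun p =>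
    vdet_wordMap_ne_zero _ (fun v => wordMap_mem_simplex _ (vertex_mem v))
      (vdet_wordMap_ne_zero _ vertex_mem vdet_vertex)
  choose N P hcover hsum using fun p => exists_cover hδ0 (hX p) (hdet p)
  set C : ℝ := 2 * 2 ^ (1 + δ) * Real.sqrt 3 ^ δ with hC
  have hC0 : 0 ≤ C := by positivity
  have hcount : dimH (range fun p : List (Fin 3) × Fin 3 => wordMap p.1 (vertex p.2)) = 0 :=
    dimH_countable (countable_range _)
  have hmain : dimH {x : E3 | ∃ c : ℕ → Fin 3, (∀ n, x ∈ cyl (List.ofFn fun i : Fin n => c i)) ∧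
      ∀ N, ∃ n, N ≤ n ∧ c n ≠ c (n + 1)} ≤ ENNReal.ofReal (1 + δ) := by
    refine dimH_le_of_infinite_cover (s := Real.toNNReal (1 + δ))
      (ι := Σ p : U × List (Fin 3), Fin (N p)) (Real.toNNReal_pos.2 (by linarith))
      (fun i => P i.1 i.2) ?_ ?_
    · rw [Real.coe_toNNReal _ (by linarith), ENNReal.tsum_sigma']
      refine ne_top_of_le_ne_top ?_ (ENNReal.tsum_le_tsum (g := fun p =>
        ENNReal.ofReal C * ENNReal.ofReal (cost δ (X p))) fun p => ?_)
      · rw [ENNReal.tsum_mul_left, ENNReal.tsum_prod', tsum_fintype]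
        refine ENNReal.mul_ne_top ENNReal.ofReal_ne_top ?_
        exact ENNReal.sum_ne_top.2 fun u _ => h u.1 u.2
      · rw [tsum_fintype, ← ENNReal.ofReal_mul hC0]
        exact hsum p
    · rintro x ⟨c, hc, hinf⟩
      let I := {n | c n ≠ c (n + 1)}
      have hI : I.Infinite := by
        rw [Set.infinite_iff_exists_gt]
        intro n
        obtain ⟨k, hk, hk'⟩ := hinf (n + 1)
        exact ⟨k, hk', by omega⟩
      let key : ∀ n ∈ I, ∃ i : Σ p : U × List (Fin 3), Fin (N p),
          x ∈ P i.1 i.2 ∧ i.1.2.length = n := by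
        intro n hn
        -- The code is cut before a change of letter: the next `m + 1` letters form the base word,
        -- the first `n` the prefix. Distinct `n` give prefixes of distinct length, hence distinct
        -- pieces.
        let p : U × List (Fin 3) := (⟨fun i => c (n + i), hn⟩, (List.ofFn fun i : Fin n => c i).reverse)
        have hx : x ∈ hull (X p) := by
          have h1 := hc (n + (m + 1))
          rw [List.ofFn_add, cyl_append] at h1
          obtain ⟨_, ⟨y, hy, rfl⟩, rfl⟩ := h1
          have h2 := wordMap_image_hull_subset (List.ofFn p.1.1) vertex_mem
            ⟨y, simplex_subset_hull_vertex hy, rfl⟩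
          have h3 := wordMap_image_hull_subset p.2.reverse
            (fun v => wordMap_mem_simplex (List.ofFn p.1.1) (vertex_mem v)) ⟨_, h2, rfl⟩
          simpa [p, X] using h3
        obtain ⟨i, hi⟩ := mem_iUnion.1 (hcover p hx)
        exact ⟨⟨p, i⟩, hi, by simp [p]⟩
      have hsub : I ⊆ (fun i : Σ p : U × List (Fin 3), Fin (N p) => i.1.2.length) ''
          {i | x ∈ P i.1 i.2} := fun n hn => by
        obtain ⟨i, hi, hin⟩ := key n hn
        exact ⟨i, hi, hin⟩
      exact Set.Infinite.of_image _ (hI.mono hsub)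
  have hsub : gasket ⊆ (range fun p : List (Fin 3) × Fin 3 => wordMap p.1 (vertex p.2)) ∪
      {x : E3 | ∃ c : ℕ → Fin 3, (∀ n, x ∈ cyl (List.ofFn fun i : Fin n => c i)) ∧
        ∀ N, ∃ n, N ≤ n ∧ c n ≠ c (n + 1)} := by
    intro x hx
    obtain ⟨c, hc⟩ := gasket_subset_coded hx
    by_cases hN : ∃ N, ∀ n, N ≤ n → c n = c (n + 1)
    · obtain ⟨N, hN⟩ := hN
      exact Or.inl (mem_range_of_eventually_const hc hN)
    · push Not at hN
      exact Or.inr ⟨c, hc, hN⟩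
  refine (dimH_mono hsub).trans ?_
  rw [dimH_union, hcount]
  exact max_le zero_le hmain

/-! ### Nonnegativity -/

theorem weight_nonneg {m : ℕ} (δ : ℝ) (j : Fin 3) (w : V m) : 0 ≤ weight δ j w := by
  refine Real.sSup_nonneg ?_
  rintro _ ⟨x, hx, rfl⟩
  exact Real.rpow_nonneg (by linarith [one_le_two_sub (cyl_subset_simplex _ hx) j]) _

theorem B_nonneg (m : ℕ) (δ : ℝ) (v w : IdxB m) : 0 ≤ B m δ v w := by
  cases w with
  | inl w =>
    refine Finset.sum_nonneg fun j _ => ?_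
    split_ifs
    · exact weight_nonneg δ j w
    · exact le_rfl
  | inr _ => exact le_rfl

theorem B_pow_nonneg (m : ℕ) (δ : ℝ) (n : ℕ) (v w : IdxB m) : 0 ≤ (B m δ ^ n) v w := by
  induction n generalizing w with
  | zero =>
    rw [pow_zero, Matrix.one_apply]
    split_ifs <;> norm_num
  | succ n ih =>
    rw [pow_succ, Matrix.mul_apply]
    exact Finset.sum_nonneg fun l _ => mul_nonneg (ih l) (B_nonneg m δ l w)

theorem B_inr (m : ℕ) (δ : ℝ) (v : IdxB m) : B m δ v (Sum.inr ()) = 0 := rfl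

theorem B_pow_succ_inr (m : ℕ) (δ : ℝ) (n : ℕ) (v : IdxB m) :
    (B m δ ^ (n + 1)) v (Sum.inr ()) = 0 := by
  rw [pow_succ, Matrix.mul_apply]
  simp [B_inr]

theorem ofReal_B_pow_succ (m : ℕ) (δ : ℝ) (n : ℕ) (v w : IdxB m) :
    ENNReal.ofReal ((B m δ ^ (n + 1)) v w) =
      ∑ l, ENNReal.ofReal ((B m δ ^ n) v l) * ENNReal.ofReal (B m δ l w) := by
  rw [pow_succ, Matrix.mul_apply, ENNReal.ofReal_sum_of_nonneg fun l _ =>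
    mul_nonneg (B_pow_nonneg m δ n v l) (B_nonneg m δ l w)]
  exact Finset.sum_congr rfl fun l _ => ENNReal.ofReal_mul (B_pow_nonneg m δ n v l)

theorem a_pos (δ : ℝ) (k : ℕ) : 0 < a δ k := by
  unfold a
  positivity

theorem b_pos (δ : ℝ) (k : ℕ) : 0 < b δ k := by
  unfold b
  positivity

/-! ### The series of the coefficients `a_k`, `b_k` -/

/-- The series `∑_{l ≥ k} a_l ∏_{i=k}^{l-1} b_i`. -/
def tailSum (δ : ℝ) (k : ℕ) : ℝ≥0∞ :=
  ∑' i : ℕ, ENNReal.ofReal (a δ (k + i) * ∏ t ∈ Finset.range i, b δ (k + t))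

theorem tailSum_term_succ (δ : ℝ) (k i : ℕ) :
    ENNReal.ofReal (a δ (k + (i + 1)) * ∏ t ∈ Finset.range (i + 1), b δ (k + t)) =
      ENNReal.ofReal (b δ k) *
        ENNReal.ofReal (a δ (k + 1 + i) * ∏ t ∈ Finset.range i, b δ (k + 1 + t)) := by
  rw [← ENNReal.ofReal_mul (b_pos δ k).le, Finset.prod_range_succ', add_zero]
  congr 1
  have h : ∀ t, b δ (k + (t + 1)) = b δ (k + 1 + t) := fun t => by rw [add_right_comm, add_assoc]
  rw [Finset.prod_congr rfl fun t _ => h t, show k + (i + 1) = k + 1 + i by ring]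
  ring

theorem tailSum_eq (δ : ℝ) (k : ℕ) :
    tailSum δ k = ENNReal.ofReal (a δ k) + ENNReal.ofReal (b δ k) * tailSum δ (k + 1) := by
  unfold tailSum
  rw [tsum_eq_zero_add' ENNReal.summable]
  simp only [tailSum_term_succ, ENNReal.tsum_mul_left]
  simp

theorem sumAB_eq (m : ℕ) (δ : ℝ) : sumAB m δ = tailSum δ m := by
  unfold sumAB tailSum
  let e : ℕ ≃ {k : ℕ // m ≤ k} :=
    { toFun := fun i => ⟨m + i, by omega⟩
      invFun := fun k => k.1 - m
      left_inv := fun i => by simp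
      right_inv := fun k => by ext; simp [k.2] }
  rw [← e.tsum_eq]
  refine tsum_congr fun i => ?_
  simp only [e, Equiv.coe_fn_mk, Finset.prod_Ico_eq_prod_range, Nat.add_sub_cancel_left]

/-! ### Comparison of the two hypotheses -/

section Comparison

variable {m : ℕ} (hm : 2 ≤ m) (δ : ℝ)

/-- The sum of the entries `(⋆, j)` of all powers of `D`. -/
def green (j : IdxD m) : ℝ≥0∞ := ∑' n, infPow (D m δ) n (Sum.inl (star m hm)) j

/-- The sum of the entries `(⋆, j)` of all positive powers of `D`. -/
def greenPos (j : IdxD m) : ℝ≥0∞ := ∑' n, infPow (D m δ) (n + 1) (Sum.inl (star m hm)) j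

theorem greenPos_le_green (j : IdxD m) : greenPos hm δ j ≤ green hm δ j :=
  ENNReal.tsum_comp_le_tsum_of_injective (add_left_injective 1)
    (fun n => infPow (D m δ) n (Sum.inl (star m hm)) j)

theorem one_le_green_star : 1 ≤ green hm δ (Sum.inl (star m hm)) := by
  refine le_trans ?_ (ENNReal.le_tsum 0)
  simp [infPow]

theorem greenPos_eq (j : IdxD m) :
    greenPos hm δ j = ∑' l, green hm δ l * ENNReal.ofReal (D m δ l j) := by
  unfold greenPos green
  simp only [infPow, ← ENNReal.tsum_mul_right]
  exact ENNReal.tsum_comm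

/-- From the state `k`, only the first steps to `⋆` and to `k + 1` are kept; the empty path at `⋆`
accounts for the term `a_k`. -/
theorem green_inr_ge (k : {k : ℕ // m ≤ k}) :
    ENNReal.ofReal (a δ k) + ENNReal.ofReal (b δ k) *
      green hm δ (Sum.inr ⟨k + 1, k.2.trans (Nat.le_succ _)⟩) ≤ green hm δ (Sum.inr k) := by
  refine le_trans ?_ (greenPos_le_green hm δ _)
  rw [greenPos_eq]
  refine le_trans ?_ (ENNReal.sum_le_tsum
    {Sum.inl (star m hm), Sum.inr ⟨k + 1, k.2.trans (Nat.le_succ _)⟩})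
  rw [Finset.sum_pair (by simp)]
  have h1 : D m δ (Sum.inl (star m hm)) (Sum.inr k) = a δ k := by
    simp [D, B_inr, star]
  have h2 : D m δ (Sum.inr ⟨k + 1, k.2.trans (Nat.le_succ _)⟩) (Sum.inr k) = b δ k := by
    simp [D, B_inr]
  rw [h1, h2, mul_comm (ENNReal.ofReal (b δ k))]
  gcongr
  exact le_mul_of_one_le_left zero_le (one_le_green_star hm δ)

theorem tailSum_le_green (k : {k : ℕ // m ≤ k}) : tailSum δ k ≤ green hm δ (Sum.inr k) := by
  unfold tailSum
  rw [ENNReal.tsum_eq_iSup_nat]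
  refine iSup_le fun N => ?_
  induction N generalizing k with
  | zero => simp
  | succ N ih =>
    rw [Finset.sum_range_succ']
    simp only [tailSum_term_succ, ← Finset.mul_sum]
    refine le_trans ?_ (green_inr_ge hm δ k)
    rw [add_comm]
    have := ih ⟨k + 1, k.2.trans (Nat.le_succ _)⟩
    simp only [add_zero, Finset.range_zero, Finset.prod_empty, mul_one]
    gcongr

/-- The inclusion of the index set of `B` into that of `D`. -/
def idxEmb (l : IdxB m) : IdxD m := Sum.map id (fun _ => ⟨m, le_rfl⟩) l

theorem idxEmb_injective : Function.Injective (idxEmb (m := m)) := by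
  rintro (v | _) (w | _) h <;> simp_all [idxEmb]

theorem D_idxEmb (l : IdxB m) (w : V m) : D m δ (idxEmb l) (Sum.inl w) = B m δ l (Sum.inl w) := by
  rcases l with v | _ <;> simp [idxEmb, D]

theorem sum_green_le (w : V m) :
    ∑ l, green hm δ (idxEmb l) * ENNReal.ofReal (B m δ l (Sum.inl w)) ≤
      greenPos hm δ (Sum.inl w) := by
  rw [greenPos_eq, ← tsum_fintype (L := SummationFilter.unconditional _)]
  refine le_trans ?_ (ENNReal.tsum_comp_le_tsum_of_injective idxEmb_injective _)
  simp only [D_idxEmb, le_refl]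

/-- Paths from `l` to `⋆` through `m` are split at the first visit to `m`. The column of `m` in `B`
vanishes, so a `B`-path meets `m` only at its end and no path is counted twice. -/
theorem sum_B_pow_le_green (N : ℕ) (l : IdxB m) :
    ∑ n ∈ Finset.range N, ENNReal.ofReal ((B m δ ^ n) (Sum.inr ()) l) *
      green hm δ (idxEmb (Sum.inr ())) ≤ green hm δ (idxEmb l) := by
  induction N generalizing l with
  | zero => simp
  | succ N ih =>
    rw [Finset.sum_range_succ']
    rcases l with w | _
    · refine le_trans ?_ ((sum_green_le hm δ w).trans (greenPos_le_green hm δ _))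
      simp only [ofReal_B_pow_succ, pow_zero, Matrix.one_apply, reduceCtorEq, if_false,
        ENNReal.ofReal_zero, zero_mul, add_zero, Finset.sum_mul]
      rw [Finset.sum_comm]
      refine Finset.sum_le_sum fun l _ => ?_
      refine le_trans (le_of_eq ?_) (mul_le_mul_left (ih l) _)
      rw [Finset.sum_mul]
      exact Finset.sum_congr rfl fun n _ => by ring
    · have h (k : ℕ) := B_pow_succ_inr m δ k (Sum.inr ())
      simp [h]

theorem sumB_mul_sumAB_le_sumD : sumB m hm δ * sumAB m δ ≤ sumD m hm δ := by
  rw [sumAB_eq]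
  have h1 : tailSum δ m ≤ green hm δ (idxEmb (Sum.inr ())) := tailSum_le_green hm δ ⟨m, le_rfl⟩
  refine (mul_le_mul_right h1 _).trans ?_
  change _ ≤ greenPos hm δ (Sum.inl (star m hm))
  refine le_trans ?_ (sum_green_le hm δ _)
  unfold sumB
  rw [← ENNReal.tsum_mul_right, ENNReal.tsum_eq_iSup_nat]
  refine iSup_le fun N => ?_
  simp only [ofReal_B_pow_succ, Finset.sum_mul]
  rw [Finset.sum_comm]
  refine Finset.sum_le_sum fun l _ => ?_
  refine le_trans (le_of_eq ?_) (mul_le_mul_left (sum_B_pow_le_green hm δ N l) _)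
  rw [Finset.sum_mul]
  exact Finset.sum_congr rfl fun n _ => by ring

end Comparison

/-! ### Words -/

theorem exists_perm {a b : Fin 3} (h : a ≠ b) :
    ∃ π : Equiv.Perm (Fin 3), π a = 0 ∧ π b = 1 := by
  revert a b; decide

theorem shiftWord_succ {m : ℕ} (j : Fin 3) (w : Fin (m + 1) → Fin 3) (i : Fin m) :
    shiftWord j w i.succ = w i.castSucc := rfl

theorem perm_shiftWord {m : ℕ} (π : Equiv.Perm (Fin 3)) (j : Fin 3) (w : Fin (m + 1) → Fin 3)
    (i : Fin (m + 1)) : π (shiftWord j w i) = shiftWord (π j) (fun i => π (w i)) i := by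
  cases i using Fin.cases with
  | zero => rfl
  | succ i => rfl

theorem IsV.zero {m k : ℕ} {w : Fin (m + 1) → Fin 3} (h : IsV m k w) (hk : 1 ≤ k) : w 0 = 0 :=
  h.1 0 hk

/-- A word whose first two letters differ is equivalent to an element of `𝒱_1`. -/
theorem exists_equiv_V {m : ℕ} (hm : 2 ≤ m) {u : Fin (m + 1) → Fin 3}
    (hu : u ⟨0, by omega⟩ ≠ u ⟨1, by omega⟩) :
    ∃ v : V m, IsV m 1 v.1 ∧ WordEquiv u v.1 := by
  obtain ⟨π, h0, h1⟩ := exists_perm hu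
  have hV : IsV m 1 fun i => π (u i) := by
    constructor
    · rintro ⟨i, hi⟩ (hi1 : i < 1)
      obtain rfl : i = 0 := by omega
      exact h0
    · rintro ⟨i, hi⟩ (rfl : i = 1)
      exact h1
  exact ⟨⟨_, 1, le_rfl, hm, hV⟩, hV, π, fun i => rfl⟩

theorem exists_adj_zero {m k : ℕ} {w : V m} (hk : k + 1 < m) (hw : IsV m k w.1) :
    ∃ v : V m, IsV m (k + 1) v.1 ∧ v.1 = shiftWord 0 w.1 ∧ Adj 0 w (Sum.inl v) := by
  have hV : IsV m (k + 1) (shiftWord 0 w.1) := by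
    constructor
    · intro i hi
      cases i using Fin.cases with
      | zero => rfl
      | succ i => exact hw.1 _ (by simpa using hi)
    · intro i hi
      cases i using Fin.cases with
      | zero => simp at hi
      | succ i => exact hw.2 _ (by simpa using hi)
  exact ⟨⟨_, k + 1, by omega, hk, hV⟩, hV, rfl, Or.inl ⟨rfl, rfl⟩⟩

theorem exists_adj_ne_zero {m : ℕ} (hm : 2 ≤ m) (w : V m) {j : Fin 3} (hj : j ≠ 0) :
    ∃ v : V m, WordEquiv (shiftWord j w.1) v.1 ∧ Adj j w (Sum.inl v) := by
  obtain ⟨k, hk1, hkm, hw⟩ := w.2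
  obtain ⟨v, hv, he⟩ := exists_equiv_V hm (u := shiftWord j w.1) (by
    have h1 : shiftWord j w.1 ⟨1, by omega⟩ = 0 := hw.1 ⟨0, by omega⟩ hk1
    rw [h1]
    exact hj)
  exact ⟨v, he, Or.inr ⟨hj, hv, he⟩⟩

/-- Two equivalent elements of `𝒱` are equal. -/
theorem V_eq_of_equiv {m : ℕ} {v w : V m} (h : WordEquiv v.1 w.1) : v = w := by
  obtain ⟨π, hπ⟩ := h
  obtain ⟨k, hk1, hkm, hv⟩ := v.2
  obtain ⟨l, hl1, hlm, hw⟩ := w.2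
  -- The first letters force `π 0 = 0`, so the first change of letter occurs at the same place; then
  -- `π 1 = 1`, and `π` is the identity.
  have h0 : π 0 = 0 := by rw [← hv.zero hk1, hπ, hw.zero hl1, hv.zero hk1]
  have hvk := hv.2 ⟨k, by omega⟩ rfl
  have hwl := hw.2 ⟨l, by omega⟩ rfl
  have hkl : k = l := by
    rcases lt_trichotomy k l with h | h | h
    · have h1 := hπ ⟨k, by omega⟩
      rw [hvk, hw.1 ⟨k, by omega⟩ h, ← h0] at h1
      exact absurd (π.injective h1) (by decide)
    · exact h
    · have h1 := hπ ⟨l, by omega⟩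
      rw [hv.1 ⟨l, by omega⟩ h, hwl, h0] at h1
      exact absurd h1 (by decide)
  subst hkl
  have h1 : π 1 = 1 := by rw [← hvk, hπ, hwl, hvk]
  have hid : ∀ x, π x = x := by
    intro x
    have e2 : π 2 = 2 := by
      have n0 : π 2 ≠ 0 := fun h => absurd (π.injective (h.trans h0.symm)) (by decide)
      have n1 : π 2 ≠ 1 := fun h => absurd (π.injective (h.trans h1.symm)) (by decide)
      omega
    fin_cases x
    · exact h0
    · exact h1
    · exact e2
  apply Subtype.ext
  funext i
  rw [← hπ, hid]

theorem WordEquiv.symm {n : ℕ} {u v : Fin n → Fin 3} (h : WordEquiv u v) : WordEquiv v u := by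
  obtain ⟨π, hπ⟩ := h
  exact ⟨π.symm, fun i => by rw [← hπ, Equiv.symm_apply_apply]⟩

theorem WordEquiv.trans {n : ℕ} {u v w : Fin n → Fin 3} (h : WordEquiv u v)
    (h' : WordEquiv v w) : WordEquiv u w := by
  obtain ⟨π, hπ⟩ := h
  obtain ⟨ρ, hρ⟩ := h'
  exact ⟨π.trans ρ, fun i => by rw [← hρ, ← hπ]; rfl⟩

/-! ### Positivity of entries of powers of `B` -/

theorem weight_bddAbove {m : ℕ} {δ : ℝ} (hδ0 : 0 ≤ 3 * δ + lam * (1 - δ)) (j : Fin 3) (w : V m) :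
    BddAbove ((fun x : E3 => (2 - x j) ^ (-(3 * δ) - lam * (1 - δ))) '' triangle w.1) := by
  refine ⟨1, ?_⟩
  rintro _ ⟨x, hx, rfl⟩
  exact Real.rpow_le_one_of_one_le_of_nonpos (one_le_two_sub (cyl_subset_simplex _ hx) j)
    (by linarith)

theorem weight_pos {m : ℕ} {δ : ℝ} (hδ0 : 0 ≤ 3 * δ + lam * (1 - δ)) (j : Fin 3) (w : V m) :
    0 < weight δ j w := by
  have hx : wordMap (List.ofFn w.1) (vertex 0) ∈ triangle w.1 := ⟨_, vertex_mem 0, rfl⟩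
  have h := le_csSup (weight_bddAbove hδ0 j w) ⟨_, hx, rfl⟩
  exact lt_of_lt_of_le (Real.rpow_pos_of_pos
    (by linarith [one_le_two_sub (cyl_subset_simplex _ hx) j]) _) h

theorem B_pos_of_adj {m : ℕ} {δ : ℝ} (hδ0 : 0 ≤ 3 * δ + lam * (1 - δ)) {j : Fin 3} {w : V m}
    {v : IdxB m} (h : Adj j w v) : 0 < B m δ v (Sum.inl w) := by
  classical
  refine lt_of_lt_of_le (weight_pos hδ0 j w) ?_
  have := Finset.single_le_sum (f := fun j => if Adj j w v then weight δ j w else 0)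
    (fun i _ => by
      split_ifs
      · exact weight_nonneg δ i w
      · exact le_rfl) (Finset.mem_univ j)
  simp only [h, if_true] at this
  simp only [B]
  convert this

theorem B_pow_succ_pos {m : ℕ} {δ : ℝ} {n : ℕ} {u v w : IdxB m} (h1 : 0 < (B m δ ^ n) u v)
    (h2 : 0 < B m δ v w) : 0 < (B m δ ^ (n + 1)) u w := by
  rw [pow_succ, Matrix.mul_apply]
  exact Finset.sum_pos' (fun l _ => mul_nonneg (B_pow_nonneg m δ n u l) (B_nonneg m δ l w))
    ⟨v, Finset.mem_univ _, mul_pos h1 h2⟩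

theorem B_pow_succ_pos' {m : ℕ} {δ : ℝ} {n : ℕ} {u v w : IdxB m} (h1 : 0 < B m δ u v)
    (h2 : 0 < (B m δ ^ n) v w) : 0 < (B m δ ^ (n + 1)) u w := by
  rw [pow_succ', Matrix.mul_apply]
  exact Finset.sum_pos' (fun l _ => mul_nonneg (B_nonneg m δ u l) (B_pow_nonneg m δ n l w))
    ⟨v, Finset.mem_univ _, mul_pos h1 h2⟩

/-- The extra index can be reached from every element of `𝒱`. -/
theorem exists_B_pow_inr_pos {m : ℕ} {δ : ℝ} (hδ0 : 0 ≤ 3 * δ + lam * (1 - δ)) (w : V m) :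
    ∃ n, 0 < (B m δ ^ (n + 1)) (Sum.inr ()) (Sum.inl w) := by
  obtain ⟨k, hk1, hkm, hw⟩ := w.2
  obtain ⟨d, hd⟩ : ∃ d, d = m - 1 - k := ⟨_, rfl⟩
  induction d generalizing k w with
  | zero =>
    obtain rfl : k = m - 1 := by omega
    exact ⟨0, by simpa using B_pos_of_adj hδ0 (j := 0) (v := Sum.inr ()) ⟨rfl, hw⟩⟩
  | succ d ih =>
    obtain ⟨v, hv, -, hadj⟩ := exists_adj_zero (by omega) hw
    obtain ⟨n, hn⟩ := ih v (k + 1) (by omega) (by omega) hv (by omega)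
    exact ⟨n + 1, B_pow_succ_pos hn (B_pos_of_adj hδ0 hadj)⟩

/-- The window of length `m + 1` at position `t` of a sequence of letters. -/
def window (m : ℕ) (c : ℕ → Fin 3) (t : ℕ) : Fin (m + 1) → Fin 3 := fun i => c (t + i)

theorem perm_window {m : ℕ} {c : ℕ → Fin 3} {t : ℕ} {π : Equiv.Perm (Fin 3)} {v : V m}
    (hπ : ∀ i, π (window m c (t + 1) i) = v.1 i) (i : Fin (m + 1)) :
    π (window m c t i) = shiftWord (π (c t)) v.1 i := by
  cases i using Fin.cases with
  | zero => rfl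
  | succ i =>
    rw [shiftWord_succ, ← hπ]
    simp only [window, Fin.val_succ, Fin.val_castSucc]
    congr 2
    omega

/-- The hypothesis `hc` excludes exactly the transition to the extra index `m`. -/
theorem exists_window_step {m : ℕ} (hm : 2 ≤ m) {δ : ℝ} (hδ0 : 0 ≤ 3 * δ + lam * (1 - δ))
    {c : ℕ → Fin 3} {t : ℕ} {v : V m} (hv : WordEquiv (window m c (t + 1)) v.1)
    (hc : ∃ i, i < m ∧ c (t + i) ≠ c t) :
    ∃ v' : V m, WordEquiv (window m c t) v'.1 ∧ 0 < B m δ (Sum.inl v') (Sum.inl v) := by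
  obtain ⟨π, hπ⟩ := hv
  have hsh : WordEquiv (window m c t) (shiftWord (π (c t)) v.1) := ⟨π, perm_window hπ⟩
  by_cases hj : π (c t) = 0
  · obtain ⟨k, hk1, hkm, hvk⟩ := v.2
    have hk : k + 1 < m := by
      by_contra hk
      obtain ⟨i, him, hi⟩ := hc
      cases i with
      | zero => exact hi rfl
      | succ i =>
        have h1 := hπ ⟨i, by omega⟩
        rw [hvk.1 ⟨i, by omega⟩ (show i < k by omega), ← hj] at h1
        apply hi
        rw [← π.injective h1]
        simp only [window]
        congr 1
        omega
    obtain ⟨v', -, hv', hadj⟩ := exists_adj_zero hk hvk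
    rw [hj, ← hv'] at hsh
    exact ⟨v', hsh, B_pos_of_adj hδ0 hadj⟩
  · obtain ⟨v', hv', hadj⟩ := exists_adj_ne_zero hm v hj
    exact ⟨v', hsh.trans hv', B_pos_of_adj hδ0 hadj⟩

/-- Every element of `𝒱` can be reached from `⋆`. -/
theorem exists_B_pow_star_pos {m : ℕ} (hm : 2 ≤ m) {δ : ℝ} (hδ0 : 0 ≤ 3 * δ + lam * (1 - δ))
    (w : V m) : ∃ n, 0 < (B m δ ^ n) (Sum.inl w) (Sum.inl (star m hm)) := by
  by_cases hws : w = star m hm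
  · exact ⟨0, by simp [hws]⟩
  obtain ⟨k, hk1, hkm, hw⟩ := w.2
  have hw0 := hw.zero hk1
  have hwk := hw.2 ⟨k, by omega⟩ rfl
  obtain ⟨σ, hσ⟩ : ∃ σ : Equiv.Perm (Fin 3), σ (w.1 (Fin.last m)) ≠ 0 := by
    by_cases h : w.1 (Fin.last m) = 0
    · exact ⟨Equiv.swap 0 1, by rw [h]; decide⟩
    · exact ⟨1, h⟩
  -- The word `σ w` followed by `⋆`, continued constantly. Sliding the window from position `m + 1`
  -- down to `0` leads from `⋆` to `w`. The choice of `σ` makes the letters at `m` and `m + 1`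
  -- differ, so no window starts with `m` equal letters; the only other danger, at `t = 1`, would
  -- force `w = ⋆`.
  let c : ℕ → Fin 3 := fun i =>
    if h : i < m + 1 then σ (w.1 ⟨i, h⟩) else if i = m + 1 then 0 else 1
  have hcw : ∀ i (h : i < m + 1), c i = σ (w.1 ⟨i, h⟩) := fun i h => dif_pos h
  have hc1 : c (m + 1) = 0 := by simp [c]
  have hc2 : ∀ i, m + 1 < i → c i = 1 := fun i hi => by
    have h1 : ¬ i < m + 1 := by omega
    have h2 : i ≠ m + 1 := by omega
    simp only [c, dif_neg h1, if_neg h2]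
  have hwin : ∀ t, t ≤ m → ∃ i, i < m ∧ c (t + i) ≠ c t := by
    intro t ht
    by_contra! hcon
    rcases Nat.lt_or_ge t 2 with ht2 | ht2
    · rcases Nat.lt_or_ge t k with htk | htk
      · have h1 := hcon (k - t) (by omega)
        rw [Nat.add_sub_cancel' htk.le, hcw k (by omega), hcw t (by omega), hwk,
          hw.1 ⟨t, by omega⟩ htk] at h1
        exact absurd (σ.injective h1) (by decide)
      · obtain rfl : t = 1 := by omega
        obtain rfl : k = 1 := by omega
        apply hws
        apply Subtype.ext
        funext i
        change w.1 i = starWord m i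
        cases i using Fin.cases with
        | zero => simpa [starWord] using hw0
        | succ i =>
          have h1 := hcon i i.2
          rw [hcw _ (by omega), hcw 1 (by omega), hwk] at h1
          have h2 := σ.injective h1
          have h3 : i.succ = ⟨1 + i, by omega⟩ := by ext; simp [add_comm]
          rw [h3, h2]
          simp [starWord, Fin.ext_iff]
    · have h1 := hcon (m - t) (by omega)
      have h2 := hcon (m + 1 - t) (by omega)
      rw [Nat.add_sub_cancel' ht] at h1
      rw [Nat.add_sub_cancel' (by omega), ← h1, hc1, hcw m (by omega)] at h2
      exact hσ h2.symm
  have hmain : ∀ d, d ≤ m + 1 → ∃ v : V m, WordEquiv (window m c (m + 1 - d)) v.1 ∧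
      ∃ n, 0 < (B m δ ^ n) (Sum.inl v) (Sum.inl (star m hm)) := by
    intro d
    induction d with
    | zero =>
      intro _
      refine ⟨star m hm, ⟨1, fun i => ?_⟩, 0, by simp⟩
      change c (m + 1 + i) = starWord m i
      cases i using Fin.cases with
      | zero => simpa [starWord] using hc1
      | succ i =>
        rw [hc2 _ (by simp)]
        simp [starWord]
    | succ d ih =>
      intro hd
      obtain ⟨v, hv, n, hn⟩ := ih (by omega)
      rw [show m + 1 - d = (m + 1 - (d + 1)) + 1 by omega] at hv
      obtain ⟨v', hv', hB⟩ := exists_window_step hm hδ0 hv (hwin _ (by omega))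
      exact ⟨v', hv', n + 1, B_pow_succ_pos' hB hn⟩
  obtain ⟨v, hv, n, hn⟩ := hmain (m + 1) le_rfl
  have hvw : WordEquiv v.1 w.1 := by
    refine hv.symm.trans (WordEquiv.symm ⟨σ, fun i => ?_⟩)
    simp only [window, Nat.sub_self, zero_add]
    exact (hcw i i.2).symm
  rw [← V_eq_of_equiv hvw]
  exact ⟨n, hn⟩

/-! ### A superharmonic vector -/

/-- The sum of the entries `(m, w)` of all powers of `B`. -/
def greenB (m : ℕ) (δ : ℝ) (w : IdxB m) : ℝ≥0∞ :=
  ∑' n, ENNReal.ofReal ((B m δ ^ n) (Sum.inr ()) w)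

theorem greenB_inl (m : ℕ) (δ : ℝ) (w : V m) :
    greenB m δ (Sum.inl w) =
      ∑ l, greenB m δ l * ENNReal.ofReal (B m δ l (Sum.inl w)) := by
  unfold greenB
  rw [tsum_eq_zero_add' ENNReal.summable]
  simp only [ofReal_B_pow_succ, pow_zero, Matrix.one_apply, reduceCtorEq, if_false,
    ENNReal.ofReal_zero, zero_add]
  rw [Summable.tsum_finsetSum fun _ _ => ENNReal.summable]
  simp only [ENNReal.tsum_mul_right]

theorem greenB_inr (m : ℕ) (δ : ℝ) : greenB m δ (Sum.inr ()) = 1 := by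
  unfold greenB
  rw [tsum_eq_zero_add' ENNReal.summable]
  simp [B_pow_succ_inr]

theorem greenB_star {m : ℕ} (hm : 2 ≤ m) (δ : ℝ) :
    greenB m δ (Sum.inl (star m hm)) = sumB m hm δ := by
  unfold greenB sumB
  rw [tsum_eq_zero_add' ENNReal.summable]
  simp

/-- Concatenation of paths from `w` to `v` and from `v` to `m`; this carries finiteness from `⋆` to
all of `𝒱`. -/
theorem greenB_mul_le (m : ℕ) (δ : ℝ) (r : ℕ) (v w : V m) :
    greenB m δ (Sum.inl v) * ENNReal.ofReal ((B m δ ^ r) (Sum.inl v) (Sum.inl w)) ≤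
      greenB m δ (Sum.inl w) := by
  unfold greenB
  rw [← ENNReal.tsum_mul_right]
  refine le_trans (ENNReal.tsum_le_tsum fun n => ?_) (ENNReal.tsum_comp_le_tsum_of_injective
    (add_left_injective r) fun n => ENNReal.ofReal ((B m δ ^ n) (Sum.inr ()) (Sum.inl w)))
  rw [← ENNReal.ofReal_mul (B_pow_nonneg m δ n _ _), pow_add, Matrix.mul_apply]
  exact ENNReal.ofReal_le_ofReal (Finset.single_le_sum
    (f := fun l => (B m δ ^ n) (Sum.inr ()) l * (B m δ ^ r) l (Sum.inl w))
    (fun l _ => mul_nonneg (B_pow_nonneg m δ n _ l) (B_pow_nonneg m δ r l _))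
    (Finset.mem_univ (Sum.inl v)))

/-- Positive weights on the states that are superharmonic for `D`. -/
theorem exists_superharmonic {m : ℕ} (hm : 2 ≤ m) {δ : ℝ} (hδ0 : 0 ≤ 3 * δ + lam * (1 - δ))
    (hyp : sumB m hm δ * sumAB m δ ≤ 1) :
    ∃ (h : V m → ℝ) (S : ℕ → ℝ), (∀ w, 0 < h w) ∧
      (∀ k, m ≤ k → 0 ≤ S k ∧ S k = a δ k + b δ k * S (k + 1)) ∧
      h (star m hm) * S m ≤ 1 ∧
      ∀ w, ∑ v, h v * B m δ (Sum.inl v) (Sum.inl w) + B m δ (Sum.inr ()) (Sum.inl w) ≤ h w := by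
  rw [sumAB_eq] at hyp
  have hpos : ∀ w : V m, greenB m δ (Sum.inl w) ≠ 0 := by
    intro w
    obtain ⟨n, hn⟩ := exists_B_pow_inr_pos hδ0 w
    exact (lt_of_lt_of_le (ENNReal.ofReal_pos.2 hn) (ENNReal.le_tsum (n + 1))).ne'
  have hstar0 := hpos (star m hm)
  rw [greenB_star] at hstar0
  have htop := ne_top_of_le_ne_top ENNReal.one_ne_top hyp
  have hS0 : tailSum δ m ≠ 0 := by
    rw [tailSum_eq]
    exact (lt_of_lt_of_le (ENNReal.ofReal_pos.2 (a_pos δ m)) le_self_add).ne'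
  -- In `[0, ∞]`, a finite product of two nonzero factors has both factors finite.
  have hstar : sumB m hm δ ≠ ⊤ := fun h => htop (by rw [h, ENNReal.top_mul hS0])
  have hSm : tailSum δ m ≠ ⊤ := fun h => htop (by rw [h, ENNReal.mul_top hstar0])
  have hS : ∀ k, m ≤ k → tailSum δ k ≠ ⊤ := by
    intro k hk
    induction k, hk using Nat.le_induction with
    | base => exact hSm
    | succ k hk ih =>
      intro h
      apply ih
      rw [tailSum_eq, h, ENNReal.mul_top (ENNReal.ofReal_pos.2 (b_pos δ k)).ne', add_top]
  have hfin : ∀ w : V m, greenB m δ (Sum.inl w) ≠ ⊤ := by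
    intro w h
    obtain ⟨n, hn⟩ := exists_B_pow_star_pos hm hδ0 w
    have h1 := greenB_mul_le m δ n w (star m hm)
    rw [h, ENNReal.top_mul (ENNReal.ofReal_pos.2 hn).ne', greenB_star] at h1
    exact hstar (top_le_iff.1 h1)
  refine ⟨fun w => (greenB m δ (Sum.inl w)).toReal, fun k => (tailSum δ k).toReal,
    fun w => ENNReal.toReal_pos (hpos w) (hfin w), fun k hk => ⟨ENNReal.toReal_nonneg, ?_⟩, ?_,
    fun w => ?_⟩
  · dsimp only
    rw [tailSum_eq, ENNReal.toReal_add ENNReal.ofReal_ne_top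
      (ENNReal.mul_ne_top ENNReal.ofReal_ne_top (hS _ (hk.trans (Nat.le_succ k)))),
      ENNReal.toReal_mul, ENNReal.toReal_ofReal (a_pos δ k).le, ENNReal.toReal_ofReal (b_pos δ k).le]
  · dsimp only
    rw [greenB_star, ← ENNReal.toReal_mul, ← ENNReal.toReal_one]
    exact ENNReal.toReal_mono ENNReal.one_ne_top hyp
  · have h1 := greenB_inl m δ w
    rw [Fintype.sum_sum_type] at h1
    simp only [Finset.univ_unique, Finset.sum_singleton, PUnit.default_eq_unit, greenB_inr,
      one_mul] at h1
    dsimp only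
    rw [h1, ENNReal.toReal_add _ ENNReal.ofReal_ne_top, ENNReal.toReal_sum]
    · simp only [ENNReal.toReal_mul, ENNReal.toReal_ofReal (B_nonneg m δ _ _), le_refl]
    · exact fun v _ => ENNReal.mul_ne_top (hfin v) ENNReal.ofReal_ne_top
    · exact ENNReal.sum_ne_top.2 fun v _ => ENNReal.mul_ne_top (hfin v) ENNReal.ofReal_ne_top

/-! ### Sums of costs over all images -/

/-- The sum of the costs of the images of a triangle under all words of length less than `n`. -/
def costSum (δ : ℝ) : ℕ → (Fin 3 → E3) → ℝ
  | 0, _ => 0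
  | n + 1, X => cost δ X + ∑ j, costSum δ n (fun v => T j (X v))

theorem costSum_nonneg (δ : ℝ) (n : ℕ) (X : Fin 3 → E3) : 0 ≤ costSum δ n X := by
  induction n generalizing X with
  | zero => exact le_rfl
  | succ n ih => exact add_nonneg (cost_nonneg δ X) (Finset.sum_nonneg fun j _ => ih _)

theorem tsum_list_le (f : List (Fin 3) → ℝ≥0∞) :
    ∑' q, f q ≤ f [] + ∑ j, ∑' q, f (j :: q) := by
  have huniv : (univ : Set (List (Fin 3))) = {[]} ∪ ⋃ j : Fin 3, range (List.cons j) := by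
    ext q
    rcases q with _ | ⟨j, q⟩ <;> simp
  rw [← tsum_univ f, huniv]
  refine (ENNReal.tsum_union_le f _ _).trans ?_
  refine add_le_add (le_of_eq (tsum_singleton _ _)) ((ENNReal.tsum_iUnion_le f _).trans ?_)
  refine Finset.sum_le_sum fun j _ => le_of_eq ?_
  exact tsum_range (g := List.cons j) f List.cons_injective

/-- Because of the reversal, the head of `q` is the map applied first, which is what the recursion
of `costSum` peels off. -/
theorem tsum_cost_le (δ : ℝ) (n : ℕ) (X : Fin 3 → E3) :
    ∑' q : List (Fin 3), (if q.length < n then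
      ENNReal.ofReal (cost δ fun v => wordMap q.reverse (X v)) else 0) ≤
      ENNReal.ofReal (costSum δ n X) := by
  induction n generalizing X with
  | zero => simp
  | succ n ih =>
    refine (tsum_list_le _).trans ?_
    rw [costSum, ENNReal.ofReal_add (cost_nonneg δ X)
      (Finset.sum_nonneg fun j _ => costSum_nonneg δ n _),
      ENNReal.ofReal_sum_of_nonneg fun j _ => costSum_nonneg δ n _]
    refine add_le_add (le_of_eq ?_) (Finset.sum_le_sum fun j _ => le_trans (le_of_eq ?_) (ih _))
    · simp [wordMap_nil]
    · refine tsum_congr fun q => ?_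
      simp only [List.length_cons, Nat.add_lt_add_iff_right, List.reverse_cons, wordMap_append,
        wordMap_cons, wordMap_nil]

theorem tsum_cost_ne_top {δ : ℝ} {X : Fin 3 → E3} {C : ℝ} (h : ∀ n, costSum δ n X ≤ C) :
    ∑' q : List (Fin 3), ENNReal.ofReal (cost δ fun v => wordMap q.reverse (X v)) ≠ ⊤ := by
  refine ne_top_of_le_ne_top (ENNReal.ofReal_ne_top (r := C)) ?_
  rw [ENNReal.tsum_eq_iSup_sum]
  refine iSup_le fun F => ?_
  let n := F.sup List.length + 1
  refine le_trans ?_ ((tsum_cost_le δ n X).trans (ENNReal.ofReal_le_ofReal (h n)))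
  refine le_trans (le_of_eq ?_) (ENNReal.sum_le_tsum F)
  refine Finset.sum_congr rfl fun q hq => ?_
  rw [if_pos (Nat.lt_succ_of_le (Finset.le_sup (f := List.length) hq))]

/-! ### Permutations of the letters -/

/-- The action of a permutation of the letters on points. -/
def permPt (π : Equiv.Perm (Fin 3)) (x : E3) : E3 := WithLp.toLp 2 fun i => x (π.symm i)

theorem permPt_apply (π : Equiv.Perm (Fin 3)) (x : E3) (i : Fin 3) :
    permPt π x i = x (π.symm i) := rfl

theorem permPt_mem_simplex (π : Equiv.Perm (Fin 3)) {x : E3} (hx : x ∈ simplex) :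
    permPt π x ∈ simplex :=
  ⟨fun _ => hx.1 _, (Equiv.sum_comp π.symm fun i => x i).trans hx.2⟩

theorem T_permPt (π : Equiv.Perm (Fin 3)) (j : Fin 3) (x : E3) :
    T (π j) (permPt π x) = permPt π (T j x) := by
  ext i
  rw [permPt_apply, T_apply, T_apply, permPt_apply, permPt_apply, Equiv.symm_apply_apply]
  by_cases h : i = π j
  · simp [h]
  · have h' : π.symm i ≠ j := fun h' => h (by rw [← h', Equiv.apply_symm_apply])
    simp [h, h']

theorem wordMap_permPt (π : Equiv.Perm (Fin 3)) (l : List (Fin 3)) (x : E3) :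
    wordMap (l.map π) (permPt π x) = permPt π (wordMap l x) := by
  induction l with
  | nil => rfl
  | cons j l ih => rw [List.map_cons, wordMap_cons, ih, T_permPt, wordMap_cons]

/-- Permuting letters permutes coordinates, so `weight` also controls triangles that have a given
state only up to permutation. -/
theorem exists_mem_triangle {n : ℕ} {π : Equiv.Perm (Fin 3)} {w : Fin n → Fin 3} {x : E3}
    (hx : x ∈ triangle fun i => π (w i)) (j : Fin 3) : ∃ y ∈ triangle w, y j = x (π j) := by
  obtain ⟨z, hz, rfl⟩ := hx
  refine ⟨_, ⟨permPt π.symm z, permPt_mem_simplex _ hz, rfl⟩, ?_⟩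
  have h1 : (List.ofFn fun i => π (w i)) = (List.ofFn w).map π := by rw [List.map_ofFn]; rfl
  have h2 : z = permPt π (permPt π.symm z) := by
    ext i; simp [permPt_apply]
  conv_rhs => rw [h1, h2, wordMap_permPt, permPt_apply, Equiv.symm_apply_apply]

/-! ### Images of triangles -/

/-- The image has a code of length `m + 2`; forgetting its last letter enlarges the triangle to that
of the shifted word. -/
theorem T_mem_triangle {m : ℕ} {u : Fin (m + 1) → Fin 3} {x : E3} (hx : x ∈ triangle u)
    (j : Fin 3) : T j x ∈ triangle (shiftWord j u) := by
  have h1 : T j x ∈ cyl (j :: List.ofFn u) := by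
    rw [cyl_cons]; exact ⟨x, hx, rfl⟩
  refine cyl_subset_of_prefix ⟨[u (Fin.last m)], ?_⟩ h1
  rw [List.ofFn_succ, List.ofFn_succ_last]
  rfl

theorem triangle_subset_cyl {m k : ℕ} (hk : k ≤ m) {w : Fin (m + 1) → Fin 3} (hw : IsV m k w)
    (π : Equiv.Perm (Fin 3)) :
    (triangle fun i => π (w i)) ⊆ cyl (List.replicate k (π 0) ++ [π 1]) := by
  refine cyl_subset_of_prefix ?_
  rw [List.prefix_iff_getElem]
  refine ⟨by simpa using hk, fun i hi => ?_⟩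
  simp only [List.length_append, List.length_replicate, List.length_singleton] at hi
  rw [List.getElem_ofFn]
  rcases Nat.lt_or_ge i k with h | h
  · rw [List.getElem_append_left (by simpa using h), List.getElem_replicate, hw.1 _ h]
  · obtain rfl : i = k := by omega
    rw [List.getElem_append_right (by simp), hw.2 _ rfl]
    simp

theorem T_mem_triangle_star {m k : ℕ} (hk : m ≤ k) {x : E3} {p q r : Fin 3} (hpr : r ≠ p)
    (hx : x ∈ cyl (List.replicate k p ++ [q])) :
    ∃ π : Equiv.Perm (Fin 3), π 0 = r ∧ π 1 = p ∧
      T r x ∈ triangle fun i => π (starWord m i) := by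
  obtain ⟨ρ, h0, h1⟩ := exists_perm hpr
  have e0 : ρ.symm 0 = r := by rw [← h0, Equiv.symm_apply_apply]
  have e1 : ρ.symm 1 = p := by rw [← h1, Equiv.symm_apply_apply]
  refine ⟨ρ.symm, e0, e1, ?_⟩
  have h2 : T r x ∈ cyl (r :: (List.replicate k p ++ [q])) := by
    rw [cyl_cons]; exact ⟨x, hx, rfl⟩
  refine cyl_subset_of_prefix ⟨List.replicate (k - m) p ++ [q], ?_⟩ h2
  rw [List.ofFn_succ]
  have h3 : (fun i : Fin m => ρ.symm (starWord m i.succ)) = fun _ => p := by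
    funext i; simp [starWord, e1]
  rw [h3, List.ofFn_const, List.cons_append, ← List.append_assoc, List.replicate_append_replicate,
    Nat.add_sub_cancel' hk]
  simp [starWord, e0]

/-! ### Comparison of the coefficients for two exponents -/

/-- The exponent `3δ + λ(1-δ)`. -/
def expo (δ : ℝ) : ℝ := 3 * δ + lam * (1 - δ)

theorem expo_lt {δ δ' : ℝ} (h : δ < δ') : expo δ < expo δ' := by
  have := lam_lt_one
  unfold expo
  nlinarith

theorem expo_pos {δ : ℝ} (h : 0 ≤ δ) : 0 < expo δ := by
  have := lam_lt_one
  have := lam_pos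
  unfold expo
  nlinarith

theorem b_antitone {δ δ' : ℝ} (h : δ < δ') (k : ℕ) : b δ' k ≤ b δ k := by
  unfold b
  refine Real.rpow_le_rpow_of_exponent_ge (by positivity) ?_ (expo_lt h).le
  rw [div_le_one (by positivity)]
  linarith

theorem exists_a_contract {δ δ' : ℝ} (h : δ < δ') :
    ∃ θ, 0 < θ ∧ θ < 1 ∧ ∀ k, 1 ≤ k → a δ' k ≤ θ * a δ k := by
  have hε : 0 < δ' - δ := by linarith
  have hη : 0 < expo δ' - expo δ := by linarith [expo_lt h]
  -- For `k ≥ 1` the base `t` lies in `[1/2, 2/3]`. The two summands change by `t^(expo δ' - expo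
  -- δ)` and by `(8 t^λ)^(-(δ' - δ))`, where `8 t^λ ≥ 4`.
  refine ⟨max ((2 / 3) ^ (expo δ' - expo δ)) ((1 / 4) ^ (δ' - δ)), by positivity,
    max_lt (Real.rpow_lt_one (by norm_num) (by norm_num) hη)
      (Real.rpow_lt_one (by norm_num) (by norm_num) hε), fun k hk => ?_⟩
  have hk' : (1 : ℝ) ≤ k := by exact_mod_cast hk
  unfold a
  set t : ℝ := ((k : ℝ) + 1) / (2 * k + 1) with ht
  have ht0 : 0 < t := by positivity
  have ht1 : t ≤ 2 / 3 := by
    rw [ht, div_le_div_iff₀ (by positivity) (by norm_num)]; linarith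
  have ht2 : 1 / 2 ≤ t := by
    rw [ht, div_le_div_iff₀ (by norm_num) (by positivity)]; linarith
  rw [mul_add]
  refine add_le_add ?_ ?_
  · change t ^ expo δ' ≤ _ * t ^ expo δ
    calc t ^ expo δ' = t ^ (expo δ' - expo δ) * t ^ expo δ := by
          rw [← Real.rpow_add ht0]; ring_nf
      _ ≤ (2 / 3) ^ (expo δ' - expo δ) * t ^ expo δ := by gcongr
      _ ≤ _ := by gcongr; exact le_max_left _ _
  · have hlam : 1 / 2 ≤ t ^ lam := by
      calc (1 / 2 : ℝ) ≤ t := ht2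
        _ = t ^ (1 : ℝ) := (Real.rpow_one t).symm
        _ ≤ t ^ lam := Real.rpow_le_rpow_of_exponent_ge ht0 (by linarith) lam_lt_one.le
    have h4 : (8 * t ^ lam) ^ (-(δ' - δ)) ≤ (1 / 4) ^ (δ' - δ) := by
      rw [one_div, ← Real.rpow_neg_eq_inv_rpow]
      exact Real.rpow_le_rpow_of_nonpos (by norm_num) (by linarith) (by linarith)
    calc 1 / 8 ^ δ' * t ^ (lam * (1 - δ'))
        = (8 * t ^ lam) ^ (-(δ' - δ)) * (1 / 8 ^ δ * t ^ (lam * (1 - δ))) := by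
          rw [Real.mul_rpow (by norm_num) (by positivity), ← Real.rpow_mul ht0.le,
            one_div, one_div, ← Real.rpow_neg (by norm_num), ← Real.rpow_neg (by norm_num)]
          have e1 : (8 : ℝ) ^ (-δ') = 8 ^ (-(δ' - δ)) * 8 ^ (-δ) := by
            rw [← Real.rpow_add (by norm_num)]; ring_nf
          have e2 : t ^ (lam * (1 - δ')) = t ^ (lam * -(δ' - δ)) * t ^ (lam * (1 - δ)) := by
            rw [← Real.rpow_add ht0]; ring_nf
          rw [e1, e2]; ring
      _ ≤ (1 / 4) ^ (δ' - δ) * (1 / 8 ^ δ * t ^ (lam * (1 - δ))) := by gcongr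
      _ ≤ _ := by gcongr; exact le_max_right _ _

theorem a_ge {δ : ℝ} (h : 0 ≤ δ) (k : ℕ) : (1 / 2) ^ expo δ ≤ a δ k := by
  unfold a
  have h1 : (1 / 2 : ℝ) ≤ ((k : ℝ) + 1) / (2 * k + 1) := by
    rw [div_le_div_iff₀ (by norm_num) (by positivity)]; linarith
  have h2 : (1 / 2 : ℝ) ^ expo δ ≤ (((k : ℝ) + 1) / (2 * k + 1)) ^ expo δ :=
    Real.rpow_le_rpow (by norm_num) h1 (expo_pos h).le
  refine h2.trans (le_add_of_nonneg_right (by positivity))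

/-! ### The recursive estimate -/

/-- The triangle with vertices `X` has state `w ∈ 𝒱`, up to a permutation of the letters. -/
def HasStateV {m : ℕ} (w : V m) (X : Fin 3 → E3) : Prop :=
  ∃ π : Equiv.Perm (Fin 3), ∀ v, X v ∈ triangle fun i => π (w.1 i)

/-- The triangle with vertices `X` has a code starting with exactly `k` equal letters. -/
def HasRun (k : ℕ) (X : Fin 3 → E3) : Prop :=
  ∃ p q : Fin 3, p ≠ q ∧ ∀ v, X v ∈ cyl (List.replicate k p ++ [q])

/-- The triangle with vertices `X` has the given state in the index set of `B`. -/
def HasState {m : ℕ} (l : IdxB m) (X : Fin 3 → E3) : Prop :=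
  Sum.elim (fun w => HasStateV w X) (fun _ => HasRun m X) l

theorem HasStateV.of_equiv {m : ℕ} {u : Fin (m + 1) → Fin 3} {w : V m} (h : WordEquiv u w.1)
    (π : Equiv.Perm (Fin 3)) {X : Fin 3 → E3} (hX : ∀ v, X v ∈ triangle fun i => π (u i)) :
    HasStateV w X := by
  obtain ⟨ρ, hρ⟩ := h.symm
  refine ⟨ρ.trans π, fun v => ?_⟩
  have : (fun i => (ρ.trans π) (w.1 i)) = fun i => π (u i) := by
    funext i
    rw [← hρ]; rfl
  rw [this]
  exact hX v

/-- The states of the images of a triangle with state in `𝒱`. -/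
theorem exists_adj_hasState {m : ℕ} (hm : 2 ≤ m) (w : V m) {π : Equiv.Perm (Fin 3)}
    {X : Fin 3 → E3} (hX : ∀ v, X v ∈ triangle fun i => π (w.1 i)) (j : Fin 3) :
    ∃ l : IdxB m, Adj j w l ∧ HasState l fun v => T (π j) (X v) := by
  have hT : ∀ v, T (π j) (X v) ∈ triangle fun i => π (shiftWord j w.1 i) := fun v => by
    simp only [perm_shiftWord]
    exact T_mem_triangle (hX v) (π j)
  by_cases hj : j = 0
  · subst hj
    obtain ⟨k, hk1, hkm, hw⟩ := w.2
    by_cases hk : k + 1 < m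
    · obtain ⟨v, -, hv, hadj⟩ := exists_adj_zero hk hw
      rw [← hv] at hT
      exact ⟨Sum.inl v, hadj, π, hT⟩
    · obtain rfl : k = m - 1 := by omega
      refine ⟨Sum.inr (), ⟨rfl, hw⟩, π 0, π 1, π.injective.ne (by decide), fun v => ?_⟩
      have h := triangle_subset_cyl (by omega) hw π (hX v)
      have hrep : List.replicate m (π 0) ++ [π 1] =
          π 0 :: (List.replicate (m - 1) (π 0) ++ [π 1]) := by
        rw [← List.cons_append, ← List.replicate_succ, Nat.sub_add_cancel (by omega)]
      rw [hrep, cyl_cons]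
      exact ⟨_, h, rfl⟩
  · obtain ⟨v, hv, hadj⟩ := exists_adj_ne_zero hm w hj
    exact ⟨Sum.inl v, hadj, HasStateV.of_equiv hv π hT⟩

/-- Away from the corners the derivatives of all maps are uniformly contracting. -/
theorem two_sub_ge_of_triangle {m : ℕ} (w : V m) {π : Equiv.Perm (Fin 3)} {x : E3}
    (hx : x ∈ triangle fun i => π (w.1 i)) (j : Fin 3) :
    1 + 1 / ((m : ℝ) + 2) ≤ 2 - x j := by
  obtain ⟨k, hk1, hkm, hw⟩ := w.2
  have h := triangle_subset_cyl hkm.le hw π hx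
  have hne : π 0 ≠ π 1 := π.injective.ne (by decide)
  have hk : (1 : ℝ) ≤ k := by exact_mod_cast hk1
  have hkm' : (k : ℝ) ≤ m := by exact_mod_cast hkm.le
  have hm0 : 1 / ((m : ℝ) + 2) ≤ 1 / (k + 2) :=
    one_div_le_one_div_of_le (by linarith) (by linarith)
  by_cases hj : j = π 0
  · subst hj
    have h1 := coord_le_of_mem_cyl_replicate_append hne h
    have h2 : ((k : ℝ) + 1) / (k + 2) = 1 - 1 / (k + 2) := by field_simp; ring
    linarith
  · have h1 := le_coord_of_mem_cyl_replicate (cyl_subset_of_prefix ⟨[π 1], rfl⟩ h)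
    have h2 := simplex_add_le_one (cyl_subset_simplex _ h) hj
    have h3 : 1 / 2 ≤ (k : ℝ) / (k + 1) := by
      rw [div_le_div_iff₀ (by norm_num) (by linarith)]; linarith
    have h4 : 1 / ((k : ℝ) + 2) ≤ 1 / 2 := one_div_le_one_div_of_le (by norm_num) (by linarith)
    linarith

/-- At the worst vertex the exponent is split: the part `expo δ` is absorbed by the weight, and the
excess gives a uniform gain because the triangle stays away from the corners. -/
theorem cost_T_le_weight {m : ℕ} {δ δ' : ℝ} (hδ0 : 0 ≤ δ) (h : δ < δ') (hδ1 : δ' ≤ 1)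
    (w : V m) {π : Equiv.Perm (Fin 3)} {X : Fin 3 → E3}
    (hX : ∀ v, X v ∈ triangle fun i => π (w.1 i)) (j : Fin 3) :
    cost δ' (fun v => T (π j) (X v)) ≤
      (1 + 1 / ((m : ℝ) + 2)) ^ (-(expo δ' - expo δ)) * weight δ j w * cost δ' X := by
  have hs : ∀ v, X v ∈ simplex := fun v => cyl_subset_simplex _ (hX v)
  obtain ⟨v, hv⟩ := Finite.exists_min fun v => 2 - X v (π j)
  have hκ : 1 + 1 / ((m : ℝ) + 2) ≤ 2 - X v (π j) := two_sub_ge_of_triangle w (hX v) _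
  have hκ0 : 0 < 1 + 1 / ((m : ℝ) + 2) := by positivity
  have hc0 : 0 < 2 - X v (π j) := lt_of_lt_of_le hκ0 hκ
  refine (cost_T_le (by linarith) hδ1 hs hc0 hv).trans
    (mul_le_mul_of_nonneg_right ?_ (cost_nonneg _ _))
  change (2 - X v (π j)) ^ (-expo δ') ≤ _
  have e1 : (2 - X v (π j)) ^ (-expo δ') =
      (2 - X v (π j)) ^ (-(expo δ' - expo δ)) * (2 - X v (π j)) ^ (-expo δ) := by
    rw [← Real.rpow_add hc0]; ring_nf
  rw [e1]
  have h1 : (2 - X v (π j)) ^ (-(expo δ' - expo δ)) ≤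
      (1 + 1 / ((m : ℝ) + 2)) ^ (-(expo δ' - expo δ)) :=
    Real.rpow_le_rpow_of_nonpos hκ0 hκ (by linarith [expo_lt h])
  have h2 : (2 - X v (π j)) ^ (-expo δ) ≤ weight δ j w := by
    obtain ⟨y, hy, hyx⟩ := exists_mem_triangle (hX v) j
    rw [← hyx, show -expo δ = -(3 * δ) - lam * (1 - δ) by unfold expo; ring]
    exact le_csSup (weight_bddAbove (expo_pos hδ0).le j w) ⟨y, hy, rfl⟩
  exact mul_le_mul h1 h2 (Real.rpow_nonneg hc0.le _) (Real.rpow_nonneg hκ0.le _)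

theorem cost_T_le_b {δ : ℝ} (hδ0 : 0 ≤ δ) (hδ1 : δ ≤ 1) {k : ℕ} {p q : Fin 3} (hpq : p ≠ q)
    {X : Fin 3 → E3} (hX : ∀ v, X v ∈ cyl (List.replicate k p ++ [q])) :
    cost δ (fun v => T p (X v)) ≤ b δ k * cost δ X := by
  have hs : ∀ v, X v ∈ simplex := fun v => cyl_subset_simplex _ (hX v)
  have hc : ∀ v, ((k : ℝ) + 3) / (k + 2) ≤ 2 - X v p := fun v => by
    have h1 := coord_le_of_mem_cyl_replicate_append hpq (hX v)
    have h2 : ((k : ℝ) + 3) / (k + 2) = 2 - (k + 1) / (k + 2) := by field_simp; ring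
    linarith
  refine (cost_T_le hδ0 hδ1 hs (by positivity) hc).trans (le_of_eq ?_)
  unfold b
  rw [Real.rpow_neg_eq_inv_rpow, inv_div]

theorem cost_T_add_le_a {δ : ℝ} (hδ0 : 0 ≤ δ) (hδ1 : δ ≤ 1) {k : ℕ} {p q r s : Fin 3}
    (hpr : p ≠ r) (hps : p ≠ s) (hrs : r ≠ s)
    {X : Fin 3 → E3} (hX : ∀ v, X v ∈ cyl (List.replicate k p ++ [q])) :
    cost δ (fun v => T r (X v)) + cost δ (fun v => T s (X v)) ≤ a δ k * cost δ X := by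
  have hs : ∀ v, X v ∈ simplex := fun v => cyl_subset_simplex _ (hX v)
  have hc : ∀ v, X v r + X v s ≤ 1 / ((k : ℝ) + 1) := fun v => by
    have h1 := le_coord_of_mem_cyl_replicate (cyl_subset_of_prefix ⟨[q], rfl⟩ (hX v))
    have h2 := simplex_sum_others (hs v) hpr hps hrs
    have h3 : (k : ℝ) / (k + 1) = 1 - 1 / (k + 1) := by field_simp; ring
    linarith
  have h1 : 1 / ((k : ℝ) + 1) ≤ 1 := by
    rw [div_le_one (by positivity)]; linarith [Nat.cast_nonneg (α := ℝ) k]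
  refine (cost_T_add_le hδ0 hδ1 hs h1 hc).trans (le_of_eq ?_)
  have h2 : 2 - 1 / ((k : ℝ) + 1) = (2 * k + 1) / (k + 1) := by field_simp; ring
  unfold a
  rw [h2, Real.rpow_neg_eq_inv_rpow, Real.rpow_neg_eq_inv_rpow, inv_div]

/-- The recursive estimate at a triangle with state in `𝒱`. -/
theorem costSum_succ_le_of_hasStateV {m : ℕ} (hm : 2 ≤ m) {δ δ' : ℝ} (hδ0 : 0 ≤ δ) (hδ : δ < δ')
    (hδ1 : δ' ≤ 1) {h : V m → ℝ} {S : ℕ → ℝ} (hpos : ∀ w, 0 < h w)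
    (hSm : h (star m hm) * S m ≤ 1)
    (hB : ∀ w, ∑ v, h v * B m δ (Sum.inl v) (Sum.inl w) + B m δ (Sum.inr ()) (Sum.inl w) ≤ h w)
    {C θ : ℝ} (hC : 0 ≤ C) (hθ : 0 ≤ θ)
    (hκ : (1 + 1 / ((m : ℝ) + 2)) ^ (-(expo δ' - expo δ)) ≤ θ)
    {w : V m} (hCw : 1 ≤ C * (1 - θ) * h w) {n : ℕ}
    (ihV : ∀ v X, HasStateV v X → costSum δ' n X ≤ C * h v * cost δ' X)
    (ihR : ∀ X, HasRun m X → costSum δ' n X ≤ C * (h (star m hm) * S m) * cost δ' X)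
    {X : Fin 3 → E3} (hX : HasStateV w X) :
    costSum δ' (n + 1) X ≤ C * h w * cost δ' X := by
  classical
  obtain ⟨π, hX⟩ := hX
  -- The extra index has value `1`; `hSm` allows the bound for runs of length `m` to be replaced by
  -- it.
  let H : IdxB m → ℝ := Sum.elim h fun _ => 1
  have hH0 : ∀ l, 0 ≤ H l := by
    rintro (v | _)
    · exact (hpos v).le
    · exact zero_le_one
  have hHle : ∀ l X, HasState l X → costSum δ' n X ≤ C * H l * cost δ' X := by
    rintro (v | _) X hX
    · exact ihV v X hX
    · refine (ihR X hX).trans (mul_le_mul_of_nonneg_right ?_ (cost_nonneg _ _))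
      exact mul_le_mul_of_nonneg_left hSm hC
  have hQ := cost_nonneg δ' X
  have hterm : ∀ j, costSum δ' n (fun v => T (π j) (X v)) ≤
      ∑ l, (if Adj j w l then weight δ j w else 0) * (C * θ * H l * cost δ' X) := by
    intro j
    obtain ⟨l, hadj, hl⟩ := exists_adj_hasState hm w hX j
    have hw0 := weight_nonneg δ j w
    have h1 : weight δ j w * (C * θ * H l * cost δ' X) ≤
        ∑ l, (if Adj j w l then weight δ j w else 0) * (C * θ * H l * cost δ' X) := by
      have := Finset.single_le_sum
        (f := fun l => (if Adj j w l then weight δ j w else 0) * (C * θ * H l * cost δ' X))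
        (fun l _ => by
          have := hH0 l
          refine mul_nonneg ?_ (by positivity)
          split_ifs <;> simp [hw0]) (Finset.mem_univ l)
      simpa only [hadj, if_true] using this
    refine le_trans ((hHle l _ hl).trans ?_) h1
    have h2 := cost_T_le_weight hδ0 hδ hδ1 w hX j
    have h3 : cost δ' (fun v => T (π j) (X v)) ≤ θ * weight δ j w * cost δ' X := by
      refine h2.trans ?_
      gcongr
    calc _ ≤ C * H l * (θ * weight δ j w * cost δ' X) :=
          mul_le_mul_of_nonneg_left h3 (mul_nonneg hC (hH0 l))
      _ = _ := by ring
  have hsum : ∑ j, costSum δ' n (fun v => T j (X v)) ≤ C * θ * h w * cost δ' X := by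
    rw [← Equiv.sum_comp π]
    refine (Finset.sum_le_sum fun j _ => hterm j).trans ?_
    rw [Finset.sum_comm]
    have hBl : ∀ l, ∑ j, (if Adj j w l then weight δ j w else 0) * (C * θ * H l * cost δ' X) =
        C * θ * cost δ' X * (H l * B m δ l (Sum.inl w)) := by
      intro l
      rw [← Finset.sum_mul]
      have : B m δ l (Sum.inl w) = ∑ j : Fin 3, if Adj j w l then weight δ j w else 0 := by
        simp only [B]
      rw [this]; ring
    simp only [hBl, ← Finset.mul_sum]
    have h1 : ∑ l, H l * B m δ l (Sum.inl w) ≤ h w := by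
      rw [Fintype.sum_sum_type]
      simpa [H] using hB w
    calc _ ≤ C * θ * cost δ' X * h w := mul_le_mul_of_nonneg_left h1 (by positivity)
      _ = _ := by ring
  rw [costSum]
  nlinarith [mul_le_mul_of_nonneg_right hCw hQ]

/-- The recursive estimate at a triangle whose code starts with at least `m` equal letters. -/
theorem costSum_succ_le_of_hasRun {m : ℕ} (hm : 2 ≤ m) {δ δ' : ℝ} (hδ0 : 0 ≤ δ) (hδ : δ < δ')
    (hδ1 : δ' ≤ 1) {h : V m → ℝ} {S : ℕ → ℝ} (hpos : ∀ w, 0 < h w)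
    (hS : ∀ k, m ≤ k → 0 ≤ S k ∧ S k = a δ k + b δ k * S (k + 1))
    {C θ : ℝ} (hC : 0 ≤ C) (hθa : ∀ k, 1 ≤ k → a δ' k ≤ θ * a δ k)
    {k : ℕ} (hk : m ≤ k) (hCk : 1 ≤ C * (1 - θ) * (h (star m hm) * a δ k)) {n : ℕ}
    (ihV : ∀ X, HasStateV (star m hm) X → costSum δ' n X ≤ C * h (star m hm) * cost δ' X)
    (ihR : ∀ X, HasRun (k + 1) X →
      costSum δ' n X ≤ C * (h (star m hm) * S (k + 1)) * cost δ' X)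
    {X : Fin 3 → E3} (hX : HasRun k X) :
    costSum δ' (n + 1) X ≤ C * (h (star m hm) * S k) * cost δ' X := by
  obtain ⟨p, q, hpq, hX⟩ := hX
  obtain ⟨r, s, hpr, hps, hrs⟩ := exists_others p
  set g := h (star m hm) with hg
  have hg0 : 0 < g := hpos _
  have hQ := cost_nonneg δ' X
  have hS1 := (hS (k + 1) (by omega)).1
  have hp : costSum δ' n (fun v => T p (X v)) ≤ C * (g * S (k + 1)) * (b δ k * cost δ' X) := by
    refine (ihR _ ⟨p, q, hpq, fun v => ?_⟩).trans (mul_le_mul_of_nonneg_left ?_ (by positivity))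
    · rw [List.replicate_succ, List.cons_append, cyl_cons]
      exact ⟨_, hX v, rfl⟩
    · refine (cost_T_le_b (by linarith) hδ1 hpq hX).trans ?_
      exact mul_le_mul_of_nonneg_right (b_antitone hδ k) hQ
  have hstar : ∀ t, t ≠ p → costSum δ' n (fun v => T t (X v)) ≤
      C * g * cost δ' (fun v => T t (X v)) := by
    intro t ht
    refine ihV _ ?_
    -- The permutation comes from one vertex and serves all three, since `⋆` involves only the
    -- letters whose images are prescribed.
    obtain ⟨π, h0, h1, -⟩ := T_mem_triangle_star hk ht (hX 0)
    refine ⟨π, fun v => ?_⟩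
    obtain ⟨ρ, h0', h1', hρ⟩ := T_mem_triangle_star hk ht (hX v)
    have : (fun i => π (starWord m i)) = fun i => ρ (starWord m i) := by
      funext i
      unfold starWord
      split_ifs
      · rw [h0, h0']
      · rw [h1, h1']
    change T t (X v) ∈ triangle fun i => π (starWord m i)
    rw [this]
    exact hρ
  have hadd : cost δ' (fun v => T r (X v)) + cost δ' (fun v => T s (X v)) ≤
      θ * a δ k * cost δ' X :=
    (cost_T_add_le_a (by linarith) hδ1 hpr hps hrs hX).trans
      (mul_le_mul_of_nonneg_right (hθa k (by omega)) hQ)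
  have hadd' := mul_le_mul_of_nonneg_left hadd (mul_nonneg hC hg0.le)
  rw [costSum, sum_perm _ hpr hps hrs, (hS k hk).2]
  have h1 := hstar r hpr.symm
  have h2 := hstar s hps.symm
  have h3 := mul_le_mul_of_nonneg_right hCk hQ
  -- No gain is needed on the term with `b_k`: the slack `C (1 - θ) g a_k` alone pays for `cost δ'
  -- X`.
  nlinarith

/-- For exponents larger than `δ` the costs of all images of a triangle with state in `𝒱` are
summable. -/
theorem exists_costSum_bound {m : ℕ} (hm : 2 ≤ m) {δ δ' : ℝ} (hδ0 : 0 ≤ δ) (hδ : δ < δ')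
    (hδ1 : δ' ≤ 1) (hyp : sumB m hm δ * sumAB m δ ≤ 1) (w : V m) {X : Fin 3 → E3}
    (hX : HasStateV w X) : ∃ C, ∀ n, costSum δ' n X ≤ C := by
  obtain ⟨h, S, hpos, hS, hSm, hB⟩ := exists_superharmonic hm (expo_pos hδ0).le hyp
  obtain ⟨θ₁, hθ₁0, hθ₁1, hθ₁⟩ := exists_a_contract hδ
  set θ₂ : ℝ := (1 + 1 / ((m : ℝ) + 2)) ^ (-(expo δ' - expo δ)) with hθ₂
  have hθ₂1 : θ₂ < 1 := by
    refine Real.rpow_lt_one_of_one_lt_of_neg ?_ (by linarith [expo_lt hδ])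
    have : 0 < 1 / ((m : ℝ) + 2) := by positivity
    linarith
  set θ := max θ₁ θ₂ with hθ
  have hθ0 : 0 < θ := lt_max_of_lt_left hθ₁0
  have hθ1 : 0 < 1 - θ := sub_pos.2 (max_lt hθ₁1 hθ₂1)
  have : Nonempty (V m) := ⟨w⟩
  obtain ⟨w₀, hw₀⟩ := Finite.exists_min h
  set α : ℝ := (1 / 2) ^ expo δ with hα
  have hα0 : 0 < α := by positivity
  set g := h (star m hm) with hg
  have hg0 : 0 < g := hpos _
  -- `ζ` is a common lower bound for all `h w` and all `g a_k`, and `C` is normalised by `C (1 - θ)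
  -- ζ = 1`. The bound is uniform in `k` because `a_k ≥ (1/2)^(expo δ)`.
  set ζ := min (h w₀) (g * α) with hζ
  have hζ0 : 0 < ζ := lt_min (hpos _) (by positivity)
  set C := 1 / ((1 - θ) * ζ) with hC
  have hC0 : 0 < C := by positivity
  have hCζ : C * (1 - θ) * ζ = 1 := by rw [hC]; field_simp
  have hCw : ∀ v, 1 ≤ C * (1 - θ) * h v := fun v => by
    refine hCζ.ge.trans ?_
    exact mul_le_mul_of_nonneg_left ((min_le_left _ _).trans (hw₀ v)) (by positivity)
  have hCk : ∀ k, 1 ≤ C * (1 - θ) * (g * a δ k) := fun k => by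
    refine hCζ.ge.trans ?_
    refine mul_le_mul_of_nonneg_left ((min_le_right _ _).trans ?_) (by positivity)
    exact mul_le_mul_of_nonneg_left (a_ge hδ0 k) hg0.le
  have hθa : ∀ k, 1 ≤ k → a δ' k ≤ θ * a δ k := fun k hk =>
    (hθ₁ k hk).trans (mul_le_mul_of_nonneg_right (le_max_left _ _) (a_pos δ k).le)
  have main : ∀ n, (∀ v X, HasStateV (m := m) v X → costSum δ' n X ≤ C * h v * cost δ' X) ∧
      ∀ k, m ≤ k → ∀ X, HasRun k X → costSum δ' n X ≤ C * (g * S k) * cost δ' X := by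
    intro n
    induction n with
    | zero =>
      refine ⟨fun v X _ => ?_, fun k hk X _ => ?_⟩
      · exact mul_nonneg (mul_nonneg hC0.le (hpos v).le) (cost_nonneg _ _)
      · exact mul_nonneg (mul_nonneg hC0.le (mul_nonneg hg0.le (hS k hk).1)) (cost_nonneg _ _)
    | succ n ih =>
      refine ⟨fun v X hX => ?_, fun k hk X hX => ?_⟩
      · exact costSum_succ_le_of_hasStateV hm hδ0 hδ hδ1 hpos hSm hB hC0.le hθ0.le
          (le_max_right _ _) (hCw v) ih.1 (ih.2 m le_rfl) hX
      · exact costSum_succ_le_of_hasRun hm hδ0 hδ hδ1 hpos hS hC0.le hθa hk (hCk k)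
          (ih.1 _) (ih.2 (k + 1) (by omega)) hX
  exact ⟨_, fun n => (main n).1 w X hX⟩

/-- The dimension bound for `0 ≤ δ < 1`. -/
theorem dimH_gasket_le_of_lt_one {m : ℕ} (hm : 2 ≤ m) {δ : ℝ} (hδ0 : 0 ≤ δ) (hδ1 : δ < 1)
    (hyp : sumB m hm δ * sumAB m δ ≤ 1) : dimH gasket ≤ ENNReal.ofReal (1 + δ) := by
  have hlim : Tendsto (fun δ' : ℝ => ENNReal.ofReal (1 + δ')) (𝓝[>] δ)
      (𝓝 (ENNReal.ofReal (1 + δ))) := by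
    have : Continuous fun δ' : ℝ => ENNReal.ofReal (1 + δ') :=
      ENNReal.continuous_ofReal.comp (by fun_prop)
    exact (this.tendsto δ).mono_left nhdsWithin_le_nhds
  refine ge_of_tendsto hlim ?_
  filter_upwards [Ioo_mem_nhdsGT hδ1] with δ' hδ'
  refine dimH_gasket_le_of_summable (hδ0.trans hδ'.1.le) hm fun u hu => ?_
  obtain ⟨v, -, hv⟩ := exists_equiv_V hm hu
  have hX : HasStateV v fun i => wordMap (List.ofFn u) (vertex i) :=
    HasStateV.of_equiv hv 1 fun i => ⟨_, vertex_mem i, rfl⟩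
  obtain ⟨C, hC⟩ := exists_costSum_bound hm hδ0 hδ'.1 hδ'.2.le hyp v hX
  exact tsum_cost_ne_top hC

theorem dimH_gasket_le {m : ℕ} (hm : 2 ≤ m) {δ : ℝ} (hδ0 : 0 ≤ δ)
    (hyp : sumB m hm δ * sumAB m δ ≤ 1) : dimH gasket ≤ ENNReal.ofReal (1 + δ) := by
  rcases lt_or_ge δ 1 with hδ1 | hδ1
  · exact dimH_gasket_le_of_lt_one hm hδ0 hδ1 hyp
  · refine dimH_gasket_le_two.trans ?_
    rw [← ENNReal.ofReal_ofNat]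
    exact ENNReal.ofReal_le_ofReal (by linarith)

end RauzyGasket

end

theorem theorem2 (m : ℕ) (hm : 2 ≤ m) (δ : ℝ)
    (hδ : (1 - RauzyGasket.lam) / (3 - RauzyGasket.lam) < δ) :
    (RauzyGasket.sumD m hm δ ≤ 1 →
      dimH RauzyGasket.gasket ≤ ENNReal.ofReal (1 + δ)) ∧
    (RauzyGasket.sumB m hm δ * RauzyGasket.sumAB m δ ≤ 1 →
      dimH RauzyGasket.gasket ≤ ENNReal.ofReal (1 + δ)) ∧
    (RauzyGasket.sumD m hm δ ≤ 1 →
      RauzyGasket.sumB m hm δ * RauzyGasket.sumAB m δ ≤ 1) := by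
  have hlam := RauzyGasket.lam_lt_one
  have hδ0 : 0 ≤ δ := (div_nonneg (by linarith) (by linarith)).trans hδ.le
  have hcomp : RauzyGasket.sumD m hm δ ≤ 1 →
      RauzyGasket.sumB m hm δ * RauzyGasket.sumAB m δ ≤ 1 :=
    (RauzyGasket.sumB_mul_sumAB_le_sumD hm δ).trans
  exact ⟨fun h => RauzyGasket.dimH_gasket_le hm hδ0 (hcomp h),
    RauzyGasket.dimH_gasket_le hm hδ0, hcomp⟩
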